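/- Let $G_0$ be the triangle graph with vertices $u_0=(0,0)$, $u_1=(1,0)$, $u_2=\frac12(1,\sqrt3)$, and for $n\ge 0$ let $G_{n+1}$ be the union of the three copies $G_n$, $G_n+2^nu_1$, $G_n+2^nu_2$ of $G_n$ (lower left, lower right and upper copy); these copies meet pairwise in three junction points. Write $V_n$ for the vertex set of $G_n$; its corners are $(0,0)$ (lower left), $2^nu_1$ (lower right) and $2^nu_2$ (upper). Under normal boundary conditions each of the three corners is joined by two additional edges to a sink $s\notin V_n$. A sandpile is a function $\eta:V_n\to\mathbb N=\{0,1,2,\dots\}$; it is stable if $\eta(v)<d_v$ for all $v\in V_n$, where $d_v$ is the degree of $v$ including the edges to the sink. A vertex $v$ with $\eta(v)\ge d_v$ may topple by sending one chip along each of its $d_v$ edges, chips sent to the sink being lost; $\eta^\circ$ is the stable sandpile reached from $\eta$ by such topplings, and $\eta\oplus\sigma=(\eta+\sigma)^\circ$. The sandpile group is $(\mathcal R_n,\oplus)$, where $\mathcal R_n$ is the set of all stable $\eta$ of the form $\eta=\eta^{\max}\oplus\sigma$ with $\sigma$ stable, and $\eta^{\max}(v)=d_v-1$. For $x,y,z\in\mathbb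 N$ let $M_1(x,y,z)$ be the sandpile on $G_1$ with values $x,y,z$ at the lower left, lower right and upper corner, and values $3,3,2$ at the midpoints of the lower, left and right side. For $n\ge1$ let $M_{n+1}(x,y,z)$ be the sandpile on $G_{n+1}$ that equals $M_n(x,3,3)$ on the lower left copy, $M_n(3,y,2)$ on the lower right copy and $M_n(3,2,z)$ on the upper copy of $G_n$. Write $M_n=M_n(2,2,2)$, and let $M_n^+$ and $M_n^-$ be the sandpiles on $G_n$ obtained from $M_n$ by rotating $G_n$ by $120^\circ$ counterclockwise and clockwise, respectively. **Theorem.** For every $n\ge1$, the identity element of the sandpile group $(\mathcal R_{n+1},\oplus)$ of $G_{n+1}$ with normal boundary conditions is the sandpile that equals $M_n$ on the lower left copy, $M_n^+$ on the lower right copy and $M_n^-$ on the upper copy of $G_n$; in particular it has the value $2$ at the three corners and at the three junction points. -/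

import Mathlib

/-! ## Sandpiles on a finite graph with a sink

The non-sink vertices are the elements of a finite type `V`; the edges between them are those of a
simple graph `G`; and `β v` is the number of edges joining `v` to the sink. -/

section Sandpile

variable {V : Type} [Fintype V] [DecidableEq V]

/-- Degree `d_v` of a non-sink vertex: edges to non-sink vertices plus edges to the sink. -/
def sinkDegree (G : SimpleGraph V) [DecidableRel G.Adj] (β : V → ℕ) (v : V) : ℕ :=
  G.degree v + β v

/-- A sandpile `η : V → ℕ` is stable if `η v < d_v` for all `v`. -/
def SandStable (G : SimpleGraph V) [DecidableRel G.Adj] (β : V → ℕ) (η : V → ℕ) : Prop :=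
  ∀ v, η v < sinkDegree G β v

/-- Toppling `v`: the vertex `v` loses `d_v` chips, each neighbour of `v` receives one chip,
and the `β v` chips sent to the sink disappear. -/
def topple (G : SimpleGraph V) [DecidableRel G.Adj] (β : V → ℕ) (η : V → ℕ) (v : V) : V → ℕ :=
  fun w => if w = v then η w - sinkDegree G β v else if G.Adj v w then η w + 1 else η w

/-- One legal toppling: only an unstable vertex may topple. -/
def ToppleStep (G : SimpleGraph V) [DecidableRel G.Adj] (β : V → ℕ) (η η' : V → ℕ) : Prop :=
  ∃ v, sinkDegree G β v ≤ η v ∧ η' = topple G β η v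

/-- `σ` is a stable sandpile reached from `η` by finitely many legal topplings. -/
def StabilizesTo (G : SimpleGraph V) [DecidableRel G.Adj] (β : V → ℕ) (η σ : V → ℕ) : Prop :=
  Relation.ReflTransGen (ToppleStep G β) η σ ∧ SandStable G β σ

theorem toppleStep_diamond (G : SimpleGraph V) [DecidableRel G.Adj] (β : V → ℕ) (a b c : V → ℕ)
    (hab : ToppleStep G β a b) (hac : ToppleStep G β a c) :
    ∃ d, Relation.ReflGen (ToppleStep G β) b d ∧
      Relation.ReflTransGen (ToppleStep G β) c d := by
  obtain ⟨v, hv, rfl⟩ := hab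
  obtain ⟨w, hw, rfl⟩ := hac
  by_cases hvw : v = w
  · subst hvw
    exact ⟨_, .refl, .refl⟩
  · have h1 : sinkDegree G β w ≤ topple G β a v w := by
      unfold topple
      rw [if_neg (Ne.symm hvw)]
      split_ifs <;> omega
    have h2 : sinkDegree G β v ≤ topple G β a w v := by
      unfold topple
      rw [if_neg hvw]
      split_ifs <;> omega
    refine ⟨topple G β (topple G β a v) w, .single ⟨w, h1, rfl⟩, .single ⟨v, h2, ?_⟩⟩
    funext u
    by_cases huv : u = v
    · subst huv
      simp only [topple, if_neg hvw, if_true]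
      split_ifs <;> omega
    · by_cases huw : u = w
      · subst huw
        simp only [topple, if_neg huv, if_true]
        split_ifs <;> omega
      · simp only [topple, if_neg huv, if_neg huw]
        split_ifs <;> omega

theorem reflTransGen_eq_of_stable (G : SimpleGraph V) [DecidableRel G.Adj] (β : V → ℕ)
    {σ τ : V → ℕ} (hσ : SandStable G β σ)
    (h : Relation.ReflTransGen (ToppleStep G β) σ τ) : σ = τ := by
  rcases Relation.ReflTransGen.cases_head h with h | ⟨c, ⟨v, hv, _⟩, _⟩
  · exact h
  · exact absurd (hσ v) (not_lt.mpr hv)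

/-- The stabilization does not depend on the order of the topplings. -/
theorem stabilizesTo_unique (G : SimpleGraph V) [DecidableRel G.Adj] (β : V → ℕ)
    {η σ τ : V → ℕ} (hσ : StabilizesTo G β η σ) (hτ : StabilizesTo G β η τ) : σ = τ := by
  obtain ⟨d, h1, h2⟩ := Relation.church_rosser (toppleStep_diamond G β) hσ.1 hτ.1
  rw [reflTransGen_eq_of_stable G β hσ.2 h1, reflTransGen_eq_of_stable G β hτ.2 h2]

theorem sum_topple (G : SimpleGraph V) [DecidableRel G.Adj] (β : V → ℕ) (η : V → ℕ) (v : V)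
    (hv : sinkDegree G β v ≤ η v) (f : V → ℤ) :
    ∑ w, (topple G β η v w : ℤ) * f w =
      ∑ w, (η w : ℤ) * f w - sinkDegree G β v * f v + ∑ w ∈ G.neighborFinset v, f w := by
  have key : ∀ w, (topple G β η v w : ℤ) * f w = (η w : ℤ) * f w
      - (if w = v then (sinkDegree G β v : ℤ) * f v else 0)
      + (if w ∈ G.neighborFinset v then f w else 0) := by
    intro w
    unfold topple
    by_cases hwv : w = v
    · subst hwv
      simp only [if_true, SimpleGraph.mem_neighborFinset, SimpleGraph.irrefl, if_false]
      push_cast [hv]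
      ring
    · simp only [if_neg hwv, SimpleGraph.mem_neighborFinset]
      split_ifs <;> push_cast <;> ring
  rw [Finset.sum_congr rfl (fun w _ => key w), Finset.sum_add_distrib, Finset.sum_sub_distrib]
  rw [Finset.sum_ite_mem, Finset.univ_inter]
  simp

/-- If from every vertex the sink can be reached (`k` decreases along a path to it), then every
sandpile stabilizes after finitely many topplings. -/
theorem exists_stabilizesTo (G : SimpleGraph V) [DecidableRel G.Adj] (β : V → ℕ) (k : V → ℕ)
    (hk : ∀ v, 0 < β v ∨ ∃ w, G.Adj v w ∧ k w < k v) (η : V → ℕ) :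
    ∃ σ, StabilizesTo G β η σ := by
  classical
  obtain ⟨B, hB⟩ : ∃ B : ℕ, ∀ v, sinkDegree G β v < B :=
    ⟨∑ v, sinkDegree G β v + 1, fun v => Nat.lt_succ_of_le
      (Finset.single_le_sum (f := sinkDegree G β) (fun _ _ => Nat.zero_le _) (Finset.mem_univ v))⟩
  obtain ⟨D, hD⟩ : ∃ D : ℕ, ∀ v, k v < D :=
    ⟨∑ v, k v + 1, fun v => Nat.lt_succ_of_le
      (Finset.single_le_sum (f := k) (fun _ _ => Nat.zero_le _) (Finset.mem_univ v))⟩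
  have hf0 : ∀ v, 0 ≤ (B : ℤ) ^ D - (B : ℤ) ^ (D - 1 - k v) := by
    intro v
    have hB1 : (1 : ℤ) ≤ B := by have := hB v; omega
    have : (B : ℤ) ^ (D - 1 - k v) ≤ (B : ℤ) ^ D := pow_le_pow_right₀ hB1 (by omega)
    linarith
  have hdec : ∀ v, ∑ w ∈ G.neighborFinset v, ((B : ℤ) ^ D - (B : ℤ) ^ (D - 1 - k w)) <
      sinkDegree G β v * ((B : ℤ) ^ D - (B : ℤ) ^ (D - 1 - k v)) := by
    intro v
    have hBd : (sinkDegree G β v : ℤ) + 1 ≤ B := by have := hB v; omega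
    have hB1 : (1 : ℤ) ≤ B := by have := hB v; omega
    have hdeg : (sinkDegree G β v : ℤ) = G.degree v + β v := by simp [sinkDegree]
    have hP : (0 : ℤ) < (B : ℤ) ^ (D - 1 - k v) := by positivity
    have hDP : (0 : ℤ) < (B : ℤ) ^ D := by positivity
    have hstep : (B : ℤ) ^ (D - 1 - k v + 1) = (B : ℤ) ^ (D - 1 - k v) * B := pow_succ _ _
    have hkD := hD v
    rw [Finset.sum_sub_distrib, Finset.sum_const, SimpleGraph.card_neighborFinset_eq_degree,
      nsmul_eq_mul]
    have hsum0 : (0 : ℤ) ≤ ∑ w ∈ G.neighborFinset v, (B : ℤ) ^ (D - 1 - k w) :=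
      Finset.sum_nonneg (fun _ _ => by positivity)
    rcases hk v with hβ | ⟨w, hvw, hkw⟩
    · have h1 : (B : ℤ) ^ (D - 1 - k v + 1) ≤ (B : ℤ) ^ D := pow_le_pow_right₀ hB1 (by omega)
      have hβ' : (1 : ℤ) ≤ β v := by exact_mod_cast hβ
      nlinarith
    · have h1 : (B : ℤ) ^ (D - 1 - k v + 1) ≤ (B : ℤ) ^ (D - 1 - k w) :=
        pow_le_pow_right₀ hB1 (by omega)
      have h2 : (B : ℤ) ^ (D - 1 - k w) ≤ ∑ w ∈ G.neighborFinset v, (B : ℤ) ^ (D - 1 - k w) :=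
        Finset.single_le_sum (f := fun w => (B : ℤ) ^ (D - 1 - k w))
          (fun _ _ => by positivity) (by simpa using hvw)
      have hβ' : (0 : ℤ) ≤ β v := by positivity
      nlinarith [mul_nonneg hβ' hDP.le]
  generalize hf : (fun v => (B : ℤ) ^ D - (B : ℤ) ^ (D - 1 - k v)) = f at *
  have hf0' : ∀ v, 0 ≤ f v := by intro v; rw [← hf]; exact hf0 v
  have hdec' : ∀ v, ∑ w ∈ G.neighborFinset v, f w < sinkDegree G β v * f v := by
    intro v; simp only [← hf] at hdec ⊢; exact hdec v
  induction h : (∑ w, (η w : ℤ) * f w).toNat using Nat.strong_induction_on generalizing η with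
  | _ m ih =>
    by_cases hs : SandStable G β η
    · exact ⟨η, .refl, hs⟩
    · simp only [SandStable, not_forall, not_lt] at hs
      obtain ⟨v, hv⟩ := hs
      have hlt := hdec' v
      have hsum := sum_topple G β η v hv f
      have hnn : 0 ≤ ∑ w, (topple G β η v w : ℤ) * f w :=
        Finset.sum_nonneg (fun w _ => mul_nonneg (by positivity) (hf0' w))
      obtain ⟨σ, hσ, hst⟩ := ih (∑ w, (topple G β η v w : ℤ) * f w).toNat (by omega)
        (topple G β η v) rfl
      exact ⟨σ, .head ⟨v, hv, rfl⟩ hσ, hst⟩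

end Sandpile

/-! ## The Sierpiński gasket graphs

The plane is written in the lattice basis `u₁ = (1, 0)`, `u₂ = (1/2, √3/2)`: the pair `(a, b)` is
the point `a u₁ + b u₂`. Hence `G_n` has lower left corner `(0, 0)`, lower right corner
`(2 ^ n, 0)` and upper corner `(0, 2 ^ n)`, and `G_{n+1}` is the union of `G_n` and its
translates by `2 ^ n u₁` and by `2 ^ n u₂`. -/

/-- The vertex set `V_n` of `G_n`. -/
def gasketVerts : ℕ → Finset (ℤ × ℤ)
  | 0 => {(0, 0), (1, 0), (0, 1)}
  | n + 1 => gasketVerts n ∪ (gasketVerts n).image (fun v => v + ((2 : ℤ) ^ n, (0 : ℤ)))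
      ∪ (gasketVerts n).image (fun v => v + ((0 : ℤ), (2 : ℤ) ^ n))

/-- Adjacency in `G_n`: `G_0` is the triangle, and the edges of `G_{n+1}` are those of its three
copies of `G_n`. -/
def gasketAdj : ℕ → ℤ × ℤ → ℤ × ℤ → Prop
  | 0, v, w => v ∈ gasketVerts 0 ∧ w ∈ gasketVerts 0 ∧ v ≠ w
  | n + 1, v, w => gasketAdj n v w
      ∨ gasketAdj n (v - ((2 : ℤ) ^ n, (0 : ℤ))) (w - ((2 : ℤ) ^ n, (0 : ℤ)))
      ∨ gasketAdj n (v - ((0 : ℤ), (2 : ℤ) ^ n)) (w - ((0 : ℤ), (2 : ℤ) ^ n))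

instance gasketAdj_decidable : ∀ (n : ℕ) (v w : ℤ × ℤ), Decidable (gasketAdj n v w)
  | 0, v, w => inferInstanceAs (Decidable (v ∈ gasketVerts 0 ∧ w ∈ gasketVerts 0 ∧ v ≠ w))
  | n + 1, v, w =>
    have := gasketAdj_decidable n v w
    have := gasketAdj_decidable n (v - ((2 : ℤ) ^ n, (0 : ℤ))) (w - ((2 : ℤ) ^ n, (0 : ℤ)))
    have := gasketAdj_decidable n (v - ((0 : ℤ), (2 : ℤ) ^ n)) (w - ((0 : ℤ), (2 : ℤ) ^ n))
    inferInstanceAs (Decidable (gasketAdj n v w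
      ∨ gasketAdj n (v - ((2 : ℤ) ^ n, (0 : ℤ))) (w - ((2 : ℤ) ^ n, (0 : ℤ)))
      ∨ gasketAdj n (v - ((0 : ℤ), (2 : ℤ) ^ n)) (w - ((0 : ℤ), (2 : ℤ) ^ n))))

theorem gasketAdj_symm : ∀ (n : ℕ) (v w : ℤ × ℤ), gasketAdj n v w → gasketAdj n w v
  | 0, _, _, h => ⟨h.2.1, h.1, h.2.2.symm⟩
  | n + 1, _, _, h => h.imp (gasketAdj_symm n _ _)
      (Or.imp (gasketAdj_symm n _ _) (gasketAdj_symm n _ _))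

theorem gasketAdj_irrefl : ∀ (n : ℕ) (v : ℤ × ℤ), ¬ gasketAdj n v v
  | 0, _, h => h.2.2 rfl
  | n + 1, _, h => h.elim (gasketAdj_irrefl n _)
      (fun h => h.elim (gasketAdj_irrefl n _) (gasketAdj_irrefl n _))

/-- The non-sink vertices of `G_n`. -/
abbrev GasketVertex (n : ℕ) : Type := {v : ℤ × ℤ // v ∈ gasketVerts n}

/-- The Sierpiński gasket graph `G_n` (without the sink). -/
def gasketGraph (n : ℕ) : SimpleGraph (GasketVertex n) where
  Adj v w := gasketAdj n v.1 w.1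
  symm := ⟨fun _ _ h => gasketAdj_symm n _ _ h⟩
  loopless := ⟨fun _ h => gasketAdj_irrefl n _ h⟩

instance gasketGraph_decidable (n : ℕ) : DecidableRel (gasketGraph n).Adj :=
  fun v w => gasketAdj_decidable n v.1 w.1

/-- Normal boundary conditions: each of the three corners of `G_n` is joined to the sink by two
edges, and no other vertex is joined to the sink. -/
def normalSink (n : ℕ) (v : GasketVertex n) : ℕ :=
  if v.1 = (0, 0) ∨ v.1 = ((2 : ℤ) ^ n, (0 : ℤ)) ∨ v.1 = ((0 : ℤ), (2 : ℤ) ^ n) then 2 else 0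

/-- Sandpile configurations on `G_n`. -/
abbrev GasketConfig (n : ℕ) : Type := GasketVertex n → ℕ

theorem gasketVerts_bounds (n : ℕ) : ∀ v ∈ gasketVerts n,
    0 ≤ v.1 ∧ 0 ≤ v.2 ∧ v.1 + v.2 ≤ (2 : ℤ) ^ n := by
  induction n with
  | zero => intro v hv; simp [gasketVerts] at hv; rcases hv with rfl | rfl | rfl <;> simp
  | succ n ih =>
    intro v hv
    simp only [gasketVerts, Finset.mem_union, Finset.mem_image] at hv
    have hN : (0 : ℤ) < 2 ^ n := by positivity
    rw [pow_succ]
    rcases hv with (hv | ⟨w, hw, rfl⟩) | ⟨w, hw, rfl⟩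
    · have := ih v hv; omega
    · have := ih w hw; simp only [Prod.fst_add, Prod.snd_add]; omega
    · have := ih w hw; simp only [Prod.fst_add, Prod.snd_add]; omega

theorem gasketVerts_corners (n : ℕ) : (0, 0) ∈ gasketVerts n ∧
    ((2 : ℤ) ^ n, (0 : ℤ)) ∈ gasketVerts n ∧ ((0 : ℤ), (2 : ℤ) ^ n) ∈ gasketVerts n := by
  induction n with
  | zero => simp [gasketVerts]
  | succ n ih =>
    refine ⟨?_, ?_, ?_⟩ <;> simp only [gasketVerts, Finset.mem_union, Finset.mem_image]
    · exact .inl (.inl ih.1)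
    · exact .inl (.inr ⟨_, ih.2.1, by ext <;> simp [pow_succ]; ring⟩)
    · exact .inr ⟨_, ih.2.2, by ext <;> simp [pow_succ]; ring⟩

theorem gasketAdj_descent (n : ℕ) : ∀ v ∈ gasketVerts n, v ≠ (0, 0) →
    ∃ w ∈ gasketVerts n, gasketAdj n v w ∧ w.1 + w.2 < v.1 + v.2 := by
  induction n with
  | zero =>
    intro v hv h0
    refine ⟨(0, 0), by simp [gasketVerts], ⟨hv, by simp [gasketVerts], h0⟩, ?_⟩
    simp [gasketVerts] at hv
    rcases hv with rfl | rfl | rfl <;> simp at h0 ⊢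
  | succ n ih =>
    have hN : (0 : ℤ) < 2 ^ n := by positivity
    have left : ∀ v ∈ gasketVerts n, v ≠ (0, 0) → ∃ w ∈ gasketVerts (n + 1),
        gasketAdj (n + 1) v w ∧ w.1 + w.2 < v.1 + v.2 := by
      intro v hv h0
      obtain ⟨w, hw, ha, hlt⟩ := ih v hv h0
      refine ⟨w, ?_, .inl ha, hlt⟩
      simp only [gasketVerts, Finset.mem_union]
      exact .inl (.inl hw)
    intro v hv h0
    have hv' := hv
    simp only [gasketVerts, Finset.mem_union, Finset.mem_image] at hv'
    rcases hv' with (hv' | ⟨u, hu, rfl⟩) | ⟨u, hu, rfl⟩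
    · exact left v hv' h0
    · by_cases hu0 : u = (0, 0)
      · subst hu0
        refine left _ ?_ h0
        simpa using (gasketVerts_corners n).2.1
      · obtain ⟨w, hw, ha, hlt⟩ := ih u hu hu0
        refine ⟨w + ((2 : ℤ) ^ n, (0 : ℤ)), ?_, .inr (.inl (by simpa using ha)), ?_⟩
        · simp only [gasketVerts, Finset.mem_union, Finset.mem_image]
          exact .inl (.inr ⟨w, hw, rfl⟩)
        · simp only [Prod.fst_add, Prod.snd_add]; omega
    · by_cases hu0 : u = (0, 0)
      · subst hu0
        refine left _ ?_ h0
        simpa using (gasketVerts_corners n).2.2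
      · obtain ⟨w, hw, ha, hlt⟩ := ih u hu hu0
        refine ⟨w + ((0 : ℤ), (2 : ℤ) ^ n), ?_, .inr (.inr (by simpa using ha)), ?_⟩
        · simp only [gasketVerts, Finset.mem_union, Finset.mem_image]
          exact .inr ⟨w, hw, rfl⟩
        · simp only [Prod.fst_add, Prod.snd_add]; omega

theorem gasket_exists_stabilizesTo (n : ℕ) (η : GasketConfig n) :
    ∃ σ, StabilizesTo (gasketGraph n) (normalSink n) η σ := by
  refine exists_stabilizesTo _ _ (fun v => (v.1.1 + v.1.2).toNat) ?_ η
  intro v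
  by_cases h0 : v.1 = (0, 0)
  · left; simp [normalSink, h0]
  · right
    obtain ⟨w, hw, ha, hlt⟩ := gasketAdj_descent n v.1 v.2 h0
    have := gasketVerts_bounds n w hw
    exact ⟨⟨w, hw⟩, ha, by simp only; omega⟩

/-! ## The sandpile group of `G_n` with normal boundary conditions -/

/-- The stabilization `η°` of `η` on `G_n` with normal boundary conditions. -/
noncomputable def gasketStab (n : ℕ) (η : GasketConfig n) : GasketConfig n :=
  (gasket_exists_stabilizesTo n η).choose

theorem gasketStab_spec (n : ℕ) (η : GasketConfig n) :
    StabilizesTo (gasketGraph n) (normalSink n) η (gasketStab n η) :=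
  (gasket_exists_stabilizesTo n η).choose_spec

theorem gasketStab_eq_iff (n : ℕ) (η σ : GasketConfig n) :
    gasketStab n η = σ ↔ StabilizesTo (gasketGraph n) (normalSink n) η σ :=
  ⟨fun h => h ▸ gasketStab_spec n η, fun h => stabilizesTo_unique _ _ (gasketStab_spec n η) h⟩

/-- The sandpile addition `η ⊕ σ = (η + σ)°`. -/
noncomputable def gasketOplus (n : ℕ) (η σ : GasketConfig n) : GasketConfig n :=
  gasketStab n (η + σ)

/-- The maximal stable configuration `v ↦ d_v - 1`. -/
def gasketMax (n : ℕ) : GasketConfig n :=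
  fun v => sinkDegree (gasketGraph n) (normalSink n) v - 1

/-- The set `R_n` of recurrent configurations of `G_n`: the stable configurations of the form
`η_max ⊕ σ` with `σ` stable. With the operation `⊕` it is the sandpile group. -/
def gasketRecurrent (n : ℕ) : Set (GasketConfig n) :=
  {η | SandStable (gasketGraph n) (normalSink n) η ∧
    ∃ σ, SandStable (gasketGraph n) (normalSink n) σ ∧ η = gasketOplus n (gasketMax n) σ}

/-- `e` is the identity element of the sandpile group `(R_n, ⊕)`. -/
def IsSandpileIdentity (n : ℕ) (e : GasketConfig n) : Prop :=
  e ∈ gasketRecurrent n ∧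
    ∀ η ∈ gasketRecurrent n, gasketOplus n e η = η ∧ gasketOplus n η e = η

theorem IsSandpileIdentity.unique (n : ℕ) (e e' : GasketConfig n) (h : IsSandpileIdentity n e)
    (h' : IsSandpileIdentity n e') : e = e' :=
  ((h'.2 e h.1).2).symm.trans (h.2 e' h'.1).1

/-! ## The configurations `M_n` and their matching

To match configurations without coercions, they are written as functions on `ℤ × ℤ`, of which only
the values on the vertices matter. -/

/-- The configuration on `G_{n+1}` equal to `f`, `g`, `h` in its lower left, lower right and upper
copy of `G_n` (used only when these agree at the common junction points). -/
def gasketMatch (n : ℕ) (f g h : ℤ × ℤ → ℕ) (v : ℤ × ℤ) : ℕ :=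
  if v ∈ gasketVerts n then f v
  else if v - ((2 : ℤ) ^ n, (0 : ℤ)) ∈ gasketVerts n then g (v - ((2 : ℤ) ^ n, (0 : ℤ)))
  else if v - ((0 : ℤ), (2 : ℤ) ^ n) ∈ gasketVerts n then h (v - ((0 : ℤ), (2 : ℤ) ^ n))
  else 0

/-- `M_n(x, y, z)`, with `x`, `y`, `z` at the lower left, lower right and upper corner.
`M_0(x, y, z)` is just the triangle with these corner values, so that `M_1(x, y, z)` has the inner
values `3` (lower side), `3` (left side) and `2` (right side). -/
def gasketM : ℕ → ℕ → ℕ → ℕ → ℤ × ℤ → ℕ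
  | 0, x, y, z => fun v =>
      if v = (0, 0) then x else if v = (1, 0) then y else if v = (0, 1) then z else 0
  | n + 1, x, y, z => gasketMatch n (gasketM n x 3 3) (gasketM n 3 y 2) (gasketM n 3 2 z)

/-- Rotation of `G_n` by 120° counterclockwise: it sends the lower left corner to the lower right
one, the lower right corner to the upper one and the upper corner to the lower left one. -/
def rotCCW (n : ℕ) (v : ℤ × ℤ) : ℤ × ℤ := ((2 : ℤ) ^ n - v.1 - v.2, v.1)

/-- Rotation of `G_n` by 120° clockwise. -/
def rotCW (n : ℕ) (v : ℤ × ℤ) : ℤ × ℤ := (v.2, (2 : ℤ) ^ n - v.1 - v.2)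

/-- `f⁺`: the configuration `f` on `G_n` carried along by the counterclockwise rotation, so that
`f⁺ (rotCCW v) = f v`. -/
def rotPlus (n : ℕ) (f : ℤ × ℤ → ℕ) : ℤ × ℤ → ℕ := fun v => f (rotCW n v)

/-- `f⁻`: the configuration `f` on `G_n` carried along by the clockwise rotation, so that
`f⁻ (rotCW v) = f v`. -/
def rotMinus (n : ℕ) (f : ℤ × ℤ → ℕ) : ℤ × ℤ → ℕ := fun v => f (rotCCW n v)

/-- The configuration on `G_{n+1}` formed by `M_n`, `M_n⁺`, `M_n⁻` in the lower left, lower right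
and upper copy of `G_n`, with the value `2` at the three corners and the three junction points. -/
def gasketIdConfig (n : ℕ) : GasketConfig (n + 1) := fun v =>
  gasketMatch n (gasketM n 2 2 2) (rotPlus n (gasketM n 2 2 2)) (rotMinus n (gasketM n 2 2 2)) v.1

/-! Consistency of the matching: it restricts to the prescribed configuration on each copy. -/

theorem gasketMatch_left (n : ℕ) (f g h : ℤ × ℤ → ℕ) (v : ℤ × ℤ) (hv : v ∈ gasketVerts n) :
    gasketMatch n f g h v = f v := by
  simp [gasketMatch, hv]

theorem gasketMatch_right (n : ℕ) (f g h : ℤ × ℤ → ℕ)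
    (hfg : f ((2 : ℤ) ^ n, (0 : ℤ)) = g (0, 0)) (v : ℤ × ℤ) (hv : v ∈ gasketVerts n) :
    gasketMatch n f g h (v + ((2 : ℤ) ^ n, (0 : ℤ))) = g v := by
  by_cases hl : v + ((2 : ℤ) ^ n, (0 : ℤ)) ∈ gasketVerts n
  · have h1 := gasketVerts_bounds n _ hl
    have h2 := gasketVerts_bounds n _ hv
    simp only [Prod.fst_add, Prod.snd_add] at h1
    have : v = (0, 0) := by ext <;> simp only <;> omega
    subst this
    rw [gasketMatch_left n f g h _ hl, ← hfg]
    simp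
  · simp [gasketMatch, hl, hv]

theorem gasketMatch_top (n : ℕ) (f g h : ℤ × ℤ → ℕ)
    (hfh : f ((0 : ℤ), (2 : ℤ) ^ n) = h (0, 0))
    (hgh : g ((0 : ℤ), (2 : ℤ) ^ n) = h ((2 : ℤ) ^ n, (0 : ℤ)))
    (v : ℤ × ℤ) (hv : v ∈ gasketVerts n) :
    gasketMatch n f g h (v + ((0 : ℤ), (2 : ℤ) ^ n)) = h v := by
  have h2 := gasketVerts_bounds n _ hv
  by_cases hl : v + ((0 : ℤ), (2 : ℤ) ^ n) ∈ gasketVerts n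
  · have h1 := gasketVerts_bounds n _ hl
    simp only [Prod.fst_add, Prod.snd_add] at h1
    have : v = (0, 0) := by ext <;> simp only <;> omega
    subst this
    rw [gasketMatch_left n f g h _ hl, ← hfh]
    simp
  · by_cases hr : v + ((0 : ℤ), (2 : ℤ) ^ n) - ((2 : ℤ) ^ n, (0 : ℤ)) ∈ gasketVerts n
    · have h1 := gasketVerts_bounds n _ hr
      simp only [Prod.fst_add, Prod.snd_add, Prod.fst_sub, Prod.snd_sub] at h1
      have : v = ((2 : ℤ) ^ n, (0 : ℤ)) := by ext <;> simp only <;> omega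
      subst this
      simp only [gasketMatch, if_neg hl, if_pos hr, ← hgh]
      congr 1
      ext <;> simp
    · simp [gasketMatch, hl, hr, hv]

/-- `M_n(x, y, z)` has the corner values `x`, `y`, `z`. -/
theorem gasketM_corners (n x y z : ℕ) : gasketM n x y z (0, 0) = x ∧
    gasketM n x y z ((2 : ℤ) ^ n, (0 : ℤ)) = y ∧ gasketM n x y z ((0 : ℤ), (2 : ℤ) ^ n) = z := by
  induction n generalizing x y z with
  | zero => simp [gasketM]
  | succ n ih =>
    obtain ⟨c0, c1, c2⟩ := gasketVerts_corners n
    refine ⟨?_, ?_, ?_⟩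
    · exact (gasketMatch_left n _ _ _ _ c0).trans (ih x 3 3).1
    · have e : ((2 : ℤ) ^ (n + 1), (0 : ℤ)) = ((2 : ℤ) ^ n, (0 : ℤ)) + ((2 : ℤ) ^ n, (0 : ℤ)) := by
        ext <;> simp [pow_succ]; ring
      rw [e]
      exact (gasketMatch_right n _ _ _ ((ih x 3 3).2.1.trans (ih 3 y 2).1.symm) _ c1).trans
        (ih 3 y 2).2.1
    · have e : ((0 : ℤ), (2 : ℤ) ^ (n + 1)) = ((0 : ℤ), (2 : ℤ) ^ n) + ((0 : ℤ), (2 : ℤ) ^ n) := by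
        ext <;> simp [pow_succ]; ring
      rw [e]
      exact (gasketMatch_top n _ _ _ ((ih x 3 3).2.2.trans (ih 3 2 z).1.symm)
        ((ih 3 y 2).2.2.trans (ih 3 2 z).2.1.symm) _ c2).trans (ih 3 2 z).2.2

/-- `M_{n+1}(x, y, z)` restricts to `M_n(x, 3, 3)`, `M_n(3, y, 2)` and `M_n(3, 2, z)` on the lower
left, lower right and upper copy of `G_n`. -/
theorem gasketM_restrict (n x y z : ℕ) (v : ℤ × ℤ) (hv : v ∈ gasketVerts n) :
    gasketM (n + 1) x y z v = gasketM n x 3 3 v ∧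
    gasketM (n + 1) x y z (v + ((2 : ℤ) ^ n, (0 : ℤ))) = gasketM n 3 y 2 v ∧
    gasketM (n + 1) x y z (v + ((0 : ℤ), (2 : ℤ) ^ n)) = gasketM n 3 2 z v :=
  ⟨gasketMatch_left n _ _ _ v hv,
    gasketMatch_right n _ _ _
      ((gasketM_corners n x 3 3).2.1.trans (gasketM_corners n 3 y 2).1.symm) v hv,
    gasketMatch_top n _ _ _
      ((gasketM_corners n x 3 3).2.2.trans (gasketM_corners n 3 2 z).1.symm)
      ((gasketM_corners n 3 y 2).2.2.trans (gasketM_corners n 3 2 z).2.1.symm) v hv⟩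

/-- The six values of `M_1(x, y, z)`. -/
theorem gasketM_one (x y z : ℕ) :
    gasketM 1 x y z (0, 0) = x ∧ gasketM 1 x y z (2, 0) = y ∧ gasketM 1 x y z (0, 2) = z ∧
    gasketM 1 x y z (1, 0) = 3 ∧ gasketM 1 x y z (0, 1) = 3 ∧ gasketM 1 x y z (1, 1) = 2 := by
  refine ⟨rfl, rfl, rfl, rfl, rfl, rfl⟩

/-- The matched configuration restricts to `M_n`, `M_n⁺` and `M_n⁻` on the lower left, lower right
and upper copy of `G_n`. -/
theorem gasketIdConfig_restrict (n : ℕ) (v : GasketVertex (n + 1)) (w : ℤ × ℤ)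
    (hw : w ∈ gasketVerts n) :
    (v.1 = w → gasketIdConfig n v = gasketM n 2 2 2 w) ∧
    (v.1 = w + ((2 : ℤ) ^ n, (0 : ℤ)) →
      gasketIdConfig n v = rotPlus n (gasketM n 2 2 2) w) ∧
    (v.1 = w + ((0 : ℤ), (2 : ℤ) ^ n) →
      gasketIdConfig n v = rotMinus n (gasketM n 2 2 2) w) := by
  obtain ⟨_, c1, c2⟩ := gasketM_corners n 2 2 2
  refine ⟨fun h => ?_, fun h => ?_, fun h => ?_⟩ <;> unfold gasketIdConfig <;> rw [h]
  · exact gasketMatch_left n _ _ _ w hw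
  · exact gasketMatch_right n _ _ _ (by simp [rotPlus, rotCW, c1, c2]) w hw
  · exact gasketMatch_top n _ _ _ (by simp [rotMinus, rotCCW, c1, c2])
      (by simp [rotPlus, rotMinus, rotCW, rotCCW, c1, c2]) w hw

/-! Two sandpiles are called equivalent if they differ by the Laplacian (with sink) of an integer
function; toppling stays within a class. The proof rests on uniqueness: a class contains at most one
stable sandpile without forbidden subconfigurations (`eq_of_noForbidden_of_sinkLaplacian`, by a
maximum principle), and every recurrent sandpile has no forbidden subconfiguration. Hence a stable
`e` without forbidden subconfigurations that is equivalent to 0 satisfies `e ⊕ η = η` for every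
recurrent `η`, because both sides lie in the class of `η`. If moreover `2e` dominates the maximal
sandpile, then adding the stabilization of `2e - η_max` to `η_max` leads to the class of `2e`, which
is that of `e`; so `e` is itself recurrent (`isSandpileIdentity_of_sinkLaplacian`).

For the glued sandpile the bounds are easy: all degrees are 4 and all values are 2 or 3. The absence
of forbidden subconfigurations is Dhar's burning test. The three outer corners burn from the sink,
the fire crosses each rotated `M_n` from its outer corner (`gasketM_burn`), and the junction points
burn last.

Equivalence to 0 needs an integer potential. The recursion for `M_n` is matched by one for functions
(`exists_gasketLap_eq_gasketM`): on the lower left copy an integer harmonic function is added, tuned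
so that the junctions get their prescribed values. Such functions come from the 1/5–2/5 extension
rule, multiplied by `5 ^ n` to clear denominators; their corner Laplacians then carry the factor `3
^ n`. Three rotated copies of the potential are glued, and an additive constant adjusts the loss to
the sink at the outer corners. -/

section Sandpile

/-! ### The Laplacian of a graph with sink. -/

variable {V : Type} [Fintype V]

/-- The Laplacian of a graph with a sink, where functions vanish at the sink. -/
def sinkLaplacian (G : SimpleGraph V) [DecidableRel G.Adj] (β : V → ℕ) (u : V → ℤ) (v : V) : ℤ :=
  sinkDegree G β v * u v - ∑ w ∈ G.neighborFinset v, u w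

theorem sinkLaplacian_add (G : SimpleGraph V) [DecidableRel G.Adj] (β : V → ℕ) (u u' : V → ℤ)
    (v : V) : sinkLaplacian G β (u + u') v = sinkLaplacian G β u v + sinkLaplacian G β u' v := by
  simp only [sinkLaplacian, Pi.add_apply, Finset.sum_add_distrib]; ring

theorem sinkLaplacian_neg (G : SimpleGraph V) [DecidableRel G.Adj] (β : V → ℕ) (u : V → ℤ)
    (v : V) : sinkLaplacian G β (-u) v = -sinkLaplacian G β u v := by
  simp only [sinkLaplacian, Pi.neg_apply, Finset.sum_neg_distrib]; ring

theorem sinkLaplacian_eq_sum (G : SimpleGraph V) [DecidableRel G.Adj] (β : V → ℕ) (u : V → ℤ)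
    (v : V) : sinkLaplacian G β u v = ∑ w ∈ G.neighborFinset v, (u v - u w) + β v * u v := by
  simp only [sinkLaplacian, sinkDegree, Finset.sum_sub_distrib, Finset.sum_const,
    SimpleGraph.card_neighborFinset_eq_degree, nsmul_eq_mul]
  push_cast; ring

/-! ### Forbidden subconfigurations and uniqueness within a class. -/

variable [DecidableEq V]

/-- Every nonempty set of vertices has a vertex carrying at least as many chips as it has
neighbours in the set, i.e. there is no forbidden subconfiguration. -/
def NoForbidden (G : SimpleGraph V) [DecidableRel G.Adj] (η : V → ℕ) : Prop :=
  ∀ S : Finset V, S.Nonempty → ∃ v ∈ S, (G.neighborFinset v ∩ S).card ≤ η v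

theorem NoForbidden.mono {G : SimpleGraph V} [DecidableRel G.Adj] {η η' : V → ℕ}
    (h : NoForbidden G η) (hle : ∀ v, η v ≤ η' v) : NoForbidden G η' := fun S hS =>
  let ⟨v, hv, hc⟩ := h S hS
  ⟨v, hv, hc.trans (hle v)⟩

/-- Only the toppled vertex `v` loses chips, so a set avoiding `v` is harmless. If `v ∈ S`, the
witness for `S \ {v}` still works for `S`: its number of neighbours in the set grows by one exactly
when it receives a chip from `v`. -/
theorem NoForbidden.toppleStep {G : SimpleGraph V} [DecidableRel G.Adj] {β η η' : V → ℕ}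
    (h : NoForbidden G η) (hstep : ToppleStep G β η η') : NoForbidden G η' := by
  obtain ⟨v, hv, rfl⟩ := hstep
  intro S hS
  by_cases hvS : v ∈ S
  · by_cases hne : (S.erase v).Nonempty
    · obtain ⟨w, hw, hc⟩ := h _ hne
      have hwv := Finset.ne_of_mem_erase hw
      refine ⟨w, Finset.mem_of_mem_erase hw, ?_⟩
      have e : G.neighborFinset w ∩ S.erase v = (G.neighborFinset w ∩ S).erase v := by
        ext x; simp only [Finset.mem_inter, Finset.mem_erase]; tauto
      rw [e] at hc
      unfold topple
      rw [if_neg hwv]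
      split_ifs with ha
      · have := Finset.pred_card_le_card_erase (s := G.neighborFinset w ∩ S) (a := v)
        omega
      · rwa [Finset.erase_eq_of_notMem] at hc
        simp [G.adj_comm w v, ha]
    · rw [Finset.not_nonempty_iff_eq_empty, Finset.erase_eq_empty_iff] at hne
      have hS' : S = {v} := hne.resolve_left hS.ne_empty
      refine ⟨v, hvS, ?_⟩
      subst hS'
      simp
  · obtain ⟨w, hw, hc⟩ := h S hS
    refine ⟨w, hw, hc.trans ?_⟩
    unfold topple
    rw [if_neg (by rintro rfl; exact hvS hw)]
    split_ifs <;> omega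

theorem NoForbidden.reflTransGen {G : SimpleGraph V} [DecidableRel G.Adj] {β η η' : V → ℕ}
    (h : NoForbidden G η) (hs : Relation.ReflTransGen (ToppleStep G β) η η') :
    NoForbidden G η' := by
  induction hs with
  | refl => exact h
  | tail _ hstep ih => exact ih.toppleStep hstep

/-- The vertex of `S` with least `k` has an edge leaving `S`, either to the sink or to a neighbour
with smaller `k`, so at most `d_v - 1` of its edges stay in `S`. -/
theorem noForbidden_of_ge_max (G : SimpleGraph V) [DecidableRel G.Adj] (β k : V → ℕ)
    (hk : ∀ v, 0 < β v ∨ ∃ w, G.Adj v w ∧ k w < k v) {η : V → ℕ}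
    (hη : ∀ v, sinkDegree G β v - 1 ≤ η v) : NoForbidden G η := by
  intro S hS
  obtain ⟨v, hv, hmin⟩ := S.exists_min_image k hS
  refine ⟨v, hv, le_trans ?_ (hη v)⟩
  have hsub : (G.neighborFinset v ∩ S).card ≤ G.degree v :=
    Finset.card_le_card Finset.inter_subset_left
  unfold sinkDegree
  rcases hk v with hβ | ⟨w, ha, hlt⟩
  · omega
  · have hlt' : (G.neighborFinset v ∩ S).card < G.degree v := by
      refine Finset.card_lt_card ⟨Finset.inter_subset_left, fun hs => ?_⟩
      have := hs ((G.mem_neighborFinset v w).2 ha)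
      exact absurd (hmin w (Finset.mem_inter.1 this).2) (not_le.2 hlt)
    omega

/-- The function `u` counts how often each vertex topples. -/
theorem exists_sinkLaplacian_of_reflTransGen (G : SimpleGraph V) [DecidableRel G.Adj]
    (β : V → ℕ) {η σ : V → ℕ} (h : Relation.ReflTransGen (ToppleStep G β) η σ) :
    ∃ u : V → ℤ, ∀ v, (η v : ℤ) = σ v + sinkLaplacian G β u v := by
  induction h with
  | refl => exact ⟨0, fun v => by simp [sinkLaplacian]⟩
  | tail _ hstep ih =>
    obtain ⟨u, hu⟩ := ih
    obtain ⟨x, hx, rfl⟩ := hstep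
    refine ⟨u + Pi.single x 1, fun v => ?_⟩
    rw [hu v, sinkLaplacian_add]
    unfold sinkLaplacian topple
    have hs : ∑ w ∈ G.neighborFinset v, (Pi.single x 1 : V → ℤ) w =
        if G.Adj x v then 1 else 0 := by
      simp [Pi.single_apply, G.adj_comm v x]
    rw [hs]
    by_cases hvx : v = x
    · subst hvx
      simp only [if_true, Pi.single_eq_same, SimpleGraph.irrefl, if_false]
      push_cast [hx]; ring
    · simp only [if_neg hvx, Pi.single_eq_of_ne hvx]
      split_ifs <;> push_cast <;> ring

/-- Maximum principle: the difference of a stable configuration and one without forbidden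
subconfigurations is not the Laplacian of a function with positive values. -/
theorem NoForbidden.nonpos_of_sinkLaplacian {G : SimpleGraph V} [DecidableRel G.Adj]
    {β η η' : V → ℕ} {u : V → ℤ} (hη : SandStable G β η) (hη' : NoForbidden G η')
    (h : ∀ v, (η v : ℤ) = η' v + sinkLaplacian G β u v) (v : V) : u v ≤ 0 := by
  by_contra! hpos
  obtain ⟨m, -, hm⟩ := Finset.univ.exists_max_image u ⟨v, Finset.mem_univ v⟩
  have hm0 : 0 < u m := hpos.trans_le (hm v (Finset.mem_univ v))
  -- On the set where `u` is maximal, each edge leaving the set, to the sink or to a vertex,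
  -- contributes at least 1 to the Laplacian because `u` is integer valued. At `x` the number of
  -- edges staying in the set is at most `η' x`, which forces `η x ≥ d_x`.
  obtain ⟨x, hx, hc⟩ := hη' (Finset.univ.filter fun w => u w = u m) ⟨m, by simp⟩
  have hx : u x = u m := by simpa using hx
  have hst : (η x : ℤ) < G.degree x + β x := by exact_mod_cast hη x
  have hxl := h x
  rw [sinkLaplacian_eq_sum] at hxl
  have hβ : (β x : ℤ) ≤ β x * u x := by
    have : (0 : ℤ) ≤ β x := by positivity
    nlinarith
  have hsum : ∑ w ∈ G.neighborFinset x, (1 - if u w = u m then 1 else 0 : ℤ) ≤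
      ∑ w ∈ G.neighborFinset x, (u x - u w) := by
    refine Finset.sum_le_sum fun w _ => ?_
    have := hm w (Finset.mem_univ w)
    split_ifs <;> omega
  have hcard : ∑ w ∈ G.neighborFinset x, (1 - if u w = u m then 1 else 0 : ℤ) =
      G.degree x - (G.neighborFinset x ∩ Finset.univ.filter fun w => u w = u m).card := by
    have e : (G.neighborFinset x ∩ Finset.univ.filter fun w => u w = u m) =
        (G.neighborFinset x).filter fun w => u w = u m := by ext; simp
    rw [Finset.sum_sub_distrib, e, Finset.sum_boole]
    simp
  have : ((G.neighborFinset x ∩ Finset.univ.filter fun w => u w = u m).card : ℤ) ≤ η' x := by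
    exact_mod_cast hc
  omega

/-- Every class modulo the image of the Laplacian contains at most one stable configuration
without forbidden subconfigurations. -/
theorem eq_of_noForbidden_of_sinkLaplacian {G : SimpleGraph V} [DecidableRel G.Adj]
    {β η η' : V → ℕ} {u : V → ℤ} (hη : SandStable G β η) (hη' : SandStable G β η')
    (hf : NoForbidden G η) (hf' : NoForbidden G η')
    (h : ∀ v, (η v : ℤ) = η' v + sinkLaplacian G β u v) : η = η' := by
  have h1 := hf'.nonpos_of_sinkLaplacian hη h
  have h2 := hf.nonpos_of_sinkLaplacian (u := -u) hη' (fun v => by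
    rw [sinkLaplacian_neg, h v]; ring)
  have hu : u = 0 := by
    funext v
    have := h2 v
    simp only [Pi.neg_apply] at this
    exact le_antisymm (h1 v) (by simp only [Pi.zero_apply]; omega)
  funext v
  have := h v
  simp only [hu, sinkLaplacian, Pi.zero_apply, mul_zero, Finset.sum_const_zero, sub_zero,
    add_zero] at this
  exact_mod_cast this

end Sandpile

/-! ### Recurrent sandpiles on the gasket and a criterion for the identity. -/

theorem gasket_sink_reachable (n : ℕ) (v : GasketVertex n) : 0 < normalSink n v ∨
    ∃ w, (gasketGraph n).Adj v w ∧ (w.1.1 + w.1.2).toNat < (v.1.1 + v.1.2).toNat := by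
  by_cases h0 : v.1 = (0, 0)
  · left; simp [normalSink, h0]
  · right
    obtain ⟨w, hw, ha, hlt⟩ := gasketAdj_descent n v.1 v.2 h0
    have := gasketVerts_bounds n w hw
    exact ⟨⟨w, hw⟩, ha, by simp only; omega⟩

/-- A recurrent sandpile is reached by topplings from one that dominates the maximal stable
sandpile. The converse implication is not needed. -/
theorem noForbidden_of_mem_gasketRecurrent {n : ℕ} {η : GasketConfig n}
    (h : η ∈ gasketRecurrent n) : NoForbidden (gasketGraph n) η := by
  obtain ⟨-, σ, -, rfl⟩ := h
  exact (noForbidden_of_ge_max _ (normalSink n) (fun v => (v.1.1 + v.1.2).toNat)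
    (gasket_sink_reachable n) fun v => Nat.le_add_right _ _).reflTransGen
    (gasketStab_spec n (gasketMax n + σ)).1

/-- A criterion for the identity of the sandpile group. -/
theorem isSandpileIdentity_of_sinkLaplacian (n : ℕ) (e : GasketConfig n)
    (hst : SandStable (gasketGraph n) (normalSink n) e) (hf : NoForbidden (gasketGraph n) e)
    (hmax : ∀ v, gasketMax n v ≤ 2 * e v) (u : GasketVertex n → ℤ)
    (hu : ∀ v, (e v : ℤ) = sinkLaplacian (gasketGraph n) (normalSink n) u v) :
    IsSandpileIdentity n e := by
  constructor
  -- Since `η_max + (2e - η_max) = 2e` is equivalent to `e`, this summand brings `η_max` into the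
  -- class of `e`. The natural subtraction is exact by `hmax`.
  · refine ⟨hst, gasketStab n (fun v => 2 * e v - gasketMax n v), (gasketStab_spec n _).2, ?_⟩
    have s1 := gasketStab_spec n (fun v => 2 * e v - gasketMax n v)
    have s2 := gasketStab_spec n
      (gasketMax n + gasketStab n (fun v => 2 * e v - gasketMax n v))
    obtain ⟨u1, h1⟩ := exists_sinkLaplacian_of_reflTransGen _ _ s1.1
    obtain ⟨u2, h2⟩ := exists_sinkLaplacian_of_reflTransGen _ _ s2.1
    refine eq_of_noForbidden_of_sinkLaplacian (u := u1 + u2 + -u) hst s2.2 hf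
      (NoForbidden.reflTransGen (noForbidden_of_ge_max _ (normalSink n)
        (fun v => (v.1.1 + v.1.2).toNat) (gasket_sink_reachable n)
        fun v => Nat.le_add_right _ _) s2.1) fun v => ?_
    have a1 := h1 v
    have a2 := h2 v
    have a3 := hu v
    have a4 := hmax v
    rw [sinkLaplacian_add, sinkLaplacian_add, sinkLaplacian_neg]
    push_cast [Pi.add_apply, a4] at a1 a2
    unfold gasketOplus
    linarith
  · intro η hη
    have key : gasketOplus n e η = η := by
      have s := gasketStab_spec n (e + η)
      obtain ⟨u1, h1⟩ := exists_sinkLaplacian_of_reflTransGen _ _ s.1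
      have hfη := noForbidden_of_mem_gasketRecurrent hη
      refine eq_of_noForbidden_of_sinkLaplacian (u := u + -u1) s.2 hη.1
        (NoForbidden.reflTransGen (hfη.mono fun v => Nat.le_add_left _ _) s.1) hfη fun v => ?_
      have a1 := h1 v
      have a2 := hu v
      rw [sinkLaplacian_add, sinkLaplacian_neg]
      push_cast [Pi.add_apply] at a1
      unfold gasketOplus
      linarith
    refine ⟨key, ?_⟩
    rw [← key]
    conv_lhs => rw [key]
    simp only [gasketOplus, add_comm]

/-! ### Sums over neighbours in the gasket -/

theorem gasketAdj_mem : ∀ (n : ℕ) {v w : ℤ × ℤ}, gasketAdj n v w →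
    v ∈ gasketVerts n ∧ w ∈ gasketVerts n
  | 0, _, _, h => ⟨h.1, h.2.1⟩
  | n + 1, v, w, h => by
    simp only [gasketVerts, Finset.mem_union, Finset.mem_image]
    rcases h with h | h | h
    · obtain ⟨h1, h2⟩ := gasketAdj_mem n h
      exact ⟨.inl (.inl h1), .inl (.inl h2)⟩
    · obtain ⟨h1, h2⟩ := gasketAdj_mem n h
      exact ⟨.inl (.inr ⟨_, h1, by simp⟩), .inl (.inr ⟨_, h2, by simp⟩)⟩
    · obtain ⟨h1, h2⟩ := gasketAdj_mem n h
      exact ⟨.inr ⟨_, h1, by simp⟩, .inr ⟨_, h2, by simp⟩⟩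

/-- The sum of `g` over the neighbours of `v` in `G_n`. -/
def gasketNbrSum (n : ℕ) (g : ℤ × ℤ → ℤ) (v : ℤ × ℤ) : ℤ :=
  ∑ w ∈ gasketVerts n, if gasketAdj n v w then g w else 0

theorem gasketNbrSum_congr {n : ℕ} {g g' : ℤ × ℤ → ℤ} (v : ℤ × ℤ)
    (h : ∀ w ∈ gasketVerts n, g w = g' w) : gasketNbrSum n g v = gasketNbrSum n g' v :=
  Finset.sum_congr rfl fun w hw => by rw [h w hw]

theorem gasketNbrSum_of_notMem {n : ℕ} (g : ℤ × ℤ → ℤ) {v : ℤ × ℤ} (hv : v ∉ gasketVerts n) :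
    gasketNbrSum n g v = 0 :=
  Finset.sum_eq_zero fun _ _ => if_neg fun h => hv (gasketAdj_mem n h).1

theorem gasketNbrSum_add (n : ℕ) (g g' : ℤ × ℤ → ℤ) (v : ℤ × ℤ) :
    gasketNbrSum n (fun w => g w + g' w) v = gasketNbrSum n g v + gasketNbrSum n g' v := by
  unfold gasketNbrSum
  rw [← Finset.sum_add_distrib]
  exact Finset.sum_congr rfl fun w _ => by split_ifs <;> simp

theorem gasketNbrSum_mono (n : ℕ) {g g' : ℤ × ℤ → ℤ} (v : ℤ × ℤ)
    (h : ∀ w ∈ gasketVerts n, gasketAdj n v w → g w ≤ g' w) :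
    gasketNbrSum n g v ≤ gasketNbrSum n g' v :=
  Finset.sum_le_sum fun w hw => by
    split_ifs with ha
    · exact h w hw ha
    · exact le_rfl

/-- Passes from the vertex type to lattice points, where translations to the copies and rotations
are maps of `ℤ × ℤ` needing no membership proofs. -/
theorem sum_neighborFinset_gasketGraph (n : ℕ) (g : ℤ × ℤ → ℤ) (v : GasketVertex n) :
    ∑ w ∈ (gasketGraph n).neighborFinset v, g w.1 = gasketNbrSum n g v.1 := by
  unfold gasketNbrSum
  rw [← Finset.sum_coe_sort (gasketVerts n), ← Finset.sum_filter]
  refine Finset.sum_congr ?_ fun _ _ => rfl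
  ext w
  rw [SimpleGraph.mem_neighborFinset, Finset.mem_filter]
  exact ⟨fun h => ⟨Finset.mem_univ _, h⟩, fun h => h.2⟩

/-- Adjacency forces `w - s` to be a vertex of `G_n`, so enlarging the range to `T` adds only zeros.
This lets the three copies be summed over the common range `gasketVerts (n + 1)`. -/
theorem gasketNbrSum_shift (n : ℕ) (g : ℤ × ℤ → ℤ) (v s : ℤ × ℤ) {T : Finset (ℤ × ℤ)}
    (hT : ∀ w ∈ gasketVerts n, w + s ∈ T) :
    ∑ w ∈ T, (if gasketAdj n (v - s) (w - s) then g w else 0) =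
      gasketNbrSum n (fun w => g (w + s)) (v - s) := by
  unfold gasketNbrSum
  symm
  have e := Finset.sum_map (gasketVerts n) (addRightEmbedding s)
    (fun w => if gasketAdj n (v - s) (w - s) then g w else 0)
  simp only [addRightEmbedding_apply, add_sub_cancel_right] at e
  rw [← e]
  refine Finset.sum_subset ?_ ?_
  · intro w hw
    obtain ⟨x, hx, rfl⟩ := Finset.mem_map.1 hw
    exact hT x hx
  · intro w _ hw
    refine if_neg fun ha => hw (Finset.mem_map.2 ⟨w - s, (gasketAdj_mem n ha).2, ?_⟩)
    simp

theorem gasketNbrSum_succ (n : ℕ) (g : ℤ × ℤ → ℤ) (v : ℤ × ℤ) :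
    gasketNbrSum (n + 1) g v = gasketNbrSum n g v
      + gasketNbrSum n (fun w => g (w + ((2 : ℤ) ^ n, (0 : ℤ)))) (v - ((2 : ℤ) ^ n, (0 : ℤ)))
      + gasketNbrSum n (fun w => g (w + ((0 : ℤ), (2 : ℤ) ^ n))) (v - ((0 : ℤ), (2 : ℤ) ^ n)) := by
  have h0 := gasketNbrSum_shift n g v (0, 0) (T := gasketVerts (n + 1)) (fun w hw => by
    simp only [gasketVerts, Finset.mem_union]; rw [Prod.mk_zero_zero, add_zero]; exact .inl (.inl hw))
  have h1 := gasketNbrSum_shift n g v ((2 : ℤ) ^ n, (0 : ℤ)) (T := gasketVerts (n + 1))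
    (fun w hw => by
      simp only [gasketVerts, Finset.mem_union, Finset.mem_image]; exact .inl (.inr ⟨w, hw, rfl⟩))
  have h2 := gasketNbrSum_shift n g v ((0 : ℤ), (2 : ℤ) ^ n) (T := gasketVerts (n + 1))
    (fun w hw => by
      simp only [gasketVerts, Finset.mem_union, Finset.mem_image]; exact .inr ⟨w, hw, rfl⟩)
  simp only [Prod.mk_zero_zero, sub_zero, add_zero] at h0
  rw [← h0, ← h1, ← h2, ← Finset.sum_add_distrib, ← Finset.sum_add_distrib]
  refine Finset.sum_congr rfl fun w _ => ?_
  -- The copies share no edge: two distinct copies meet in a single point, so an edge in both would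
  -- be a loop.
  have key : ∀ s t : ℤ × ℤ, gasketAdj n (v - s) (w - s) → gasketAdj n (v - t) (w - t) →
      (s = (0, 0) ∨ s = ((2 : ℤ) ^ n, (0 : ℤ)) ∨ s = ((0 : ℤ), (2 : ℤ) ^ n)) →
      (t = (0, 0) ∨ t = ((2 : ℤ) ^ n, (0 : ℤ)) ∨ t = ((0 : ℤ), (2 : ℤ) ^ n)) → s = t := by
    intro s t h h' hs ht
    by_contra hst
    obtain ⟨a1, a2⟩ := gasketAdj_mem n h
    obtain ⟨b1, b2⟩ := gasketAdj_mem n h'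
    have a1 := gasketVerts_bounds n _ a1
    have a2 := gasketVerts_bounds n _ a2
    have b1 := gasketVerts_bounds n _ b1
    have b2 := gasketVerts_bounds n _ b2
    have hvw : v = w := by
      rcases hs with rfl | rfl | rfl <;> rcases ht with rfl | rfl | rfl <;>
        first
        | exact absurd rfl hst
        | (simp only [Prod.fst_sub, Prod.snd_sub] at a1 a2 b1 b2
           ext <;> omega)
    exact gasketAdj_irrefl n _ (hvw ▸ h)
  have hN : (2 : ℤ) ^ n ≠ 0 := by positivity
  have k01 : gasketAdj n v w →
      ¬ gasketAdj n (v - ((2 : ℤ) ^ n, (0 : ℤ))) (w - ((2 : ℤ) ^ n, (0 : ℤ))) := fun h h' =>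
    hN (congrArg Prod.fst (key 0 _ (by rwa [sub_zero, sub_zero]) h' (.inl rfl) (by simp))).symm
  have k02 : gasketAdj n v w →
      ¬ gasketAdj n (v - ((0 : ℤ), (2 : ℤ) ^ n)) (w - ((0 : ℤ), (2 : ℤ) ^ n)) := fun h h' =>
    hN (congrArg Prod.snd (key 0 _ (by rwa [sub_zero, sub_zero]) h' (.inl rfl) (by simp))).symm
  have k12 : gasketAdj n (v - ((2 : ℤ) ^ n, (0 : ℤ))) (w - ((2 : ℤ) ^ n, (0 : ℤ))) →
      ¬ gasketAdj n (v - ((0 : ℤ), (2 : ℤ) ^ n)) (w - ((0 : ℤ), (2 : ℤ) ^ n)) := fun h h' =>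
    hN (congrArg Prod.fst (key _ _ h h' (by simp) (by simp)))
  have hsucc : gasketAdj (n + 1) v w ↔ gasketAdj n v w
    ∨ gasketAdj n (v - ((2 : ℤ) ^ n, (0 : ℤ))) (w - ((2 : ℤ) ^ n, (0 : ℤ)))
    ∨ gasketAdj n (v - ((0 : ℤ), (2 : ℤ) ^ n)) (w - ((0 : ℤ), (2 : ℤ) ^ n)) := Iff.rfl
  by_cases c0 : gasketAdj n v w
  · rw [if_pos (hsucc.2 (.inl c0)), if_pos c0, if_neg (k01 c0), if_neg (k02 c0)]; ring
  by_cases c1 : gasketAdj n (v - ((2 : ℤ) ^ n, (0 : ℤ))) (w - ((2 : ℤ) ^ n, (0 : ℤ)))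
  · rw [if_pos (hsucc.2 (.inr (.inl c1))), if_neg c0, if_pos c1, if_neg (k12 c1)]; ring
  by_cases c2 : gasketAdj n (v - ((0 : ℤ), (2 : ℤ) ^ n)) (w - ((0 : ℤ), (2 : ℤ) ^ n))
  · rw [if_pos (hsucc.2 (.inr (.inr c2))), if_neg c0, if_neg c1, if_pos c2]; ring
  · rw [if_neg (fun h => (hsucc.1 h).elim c0 (Or.elim · c1 c2)), if_neg c0, if_neg c1,
      if_neg c2]; ring

/-! ### Corners, inner vertices and junction points. -/

/-- The vertices of `G_n` other than the corners. -/
def IsGasketInner (n : ℕ) (v : ℤ × ℤ) : Prop :=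
  v ∈ gasketVerts n ∧ v ≠ (0, 0) ∧ v ≠ ((2 : ℤ) ^ n, (0 : ℤ)) ∧ v ≠ ((0 : ℤ), (2 : ℤ) ^ n)

theorem not_isGasketInner_zero (v : ℤ × ℤ) : ¬ IsGasketInner 0 v := by
  rintro ⟨h, h0, h1, h2⟩
  simp [gasketVerts] at h h1 h2 h0
  tauto

theorem IsGasketInner.bounds {n : ℕ} {v : ℤ × ℤ} (h : IsGasketInner n v) :
    0 ≤ v.1 ∧ 0 ≤ v.2 ∧ v.1 + v.2 ≤ 2 ^ n ∧ 0 < v.1 + v.2 ∧ v.1 < 2 ^ n ∧ v.2 < 2 ^ n := by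
  obtain ⟨hv, h0, h1, h2⟩ := h
  have hb := gasketVerts_bounds n v hv
  have e : ∀ a b : ℤ, v ≠ (a, b) → ¬ (v.1 = a ∧ v.2 = b) := fun a b h h' =>
    h (Prod.ext h'.1 h'.2)
  have := e _ _ h0
  have := e _ _ h1
  have := e _ _ h2
  omega

theorem mem_gasketVerts_succ_iff (n : ℕ) (v : ℤ × ℤ) : v ∈ gasketVerts (n + 1) ↔
    v ∈ gasketVerts n ∨ (∃ w ∈ gasketVerts n, v = w + ((2 : ℤ) ^ n, (0 : ℤ))) ∨
      ∃ w ∈ gasketVerts n, v = w + ((0 : ℤ), (2 : ℤ) ^ n) := by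
  simp only [gasketVerts, Finset.mem_union, Finset.mem_image, or_assoc, eq_comm]

theorem eq_corner_or_isGasketInner {n : ℕ} {v : ℤ × ℤ} (h : v ∈ gasketVerts n) :
    v = (0, 0) ∨ v = ((2 : ℤ) ^ n, (0 : ℤ)) ∨ v = ((0 : ℤ), (2 : ℤ) ^ n) ∨
      IsGasketInner n v := by
  unfold IsGasketInner; tauto

/-- The inner vertices of `G_{n+1}` are those of its three copies of `G_n` and the three
junction points. -/
theorem IsGasketInner.succ_cases {n : ℕ} {P : ℤ × ℤ → Prop}
    (hl : ∀ v, IsGasketInner n v → P v)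
    (hr : ∀ v, IsGasketInner n v → P (v + ((2 : ℤ) ^ n, (0 : ℤ))))
    (ht : ∀ v, IsGasketInner n v → P (v + ((0 : ℤ), (2 : ℤ) ^ n)))
    (hlr : P ((2 : ℤ) ^ n, (0 : ℤ))) (hlt : P ((0 : ℤ), (2 : ℤ) ^ n))
    (hrt : P ((2 : ℤ) ^ n, (2 : ℤ) ^ n)) {v : ℤ × ℤ} (h : IsGasketInner (n + 1) v) : P v := by
  obtain ⟨hv, h0, h1, h2⟩ := h
  rcases (mem_gasketVerts_succ_iff n v).1 hv with hw | ⟨w, hw, rfl⟩ | ⟨w, hw, rfl⟩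
  · rcases eq_corner_or_isGasketInner hw with rfl | rfl | rfl | hi
    · exact absurd rfl h0
    · exact hlr
    · exact hlt
    · exact hl _ hi
  · rcases eq_corner_or_isGasketInner hw with rfl | rfl | rfl | hi
    · simpa using hlr
    · exact absurd (by ext <;> simp [pow_succ]; ring) h1
    · simpa using hrt
    · exact hr _ hi
  · rcases eq_corner_or_isGasketInner hw with rfl | rfl | rfl | hi
    · simpa using hlt
    · simpa using hrt
    · exact absurd (by ext <;> simp [pow_succ]; ring) h2
    · exact ht _ hi

theorem notMem_gasketVerts {n : ℕ} {v : ℤ × ℤ}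
    (h : v.1 < 0 ∨ v.2 < 0 ∨ 2 ^ n < v.1 + v.2) : v ∉ gasketVerts n := fun hv => by
  have := gasketVerts_bounds n v hv
  omega

/-- An inner vertex of one copy lies in neither of the other two, so their contributions vanish. -/
theorem gasketNbrSum_succ_left {n : ℕ} (g : ℤ × ℤ → ℤ) {v : ℤ × ℤ} (hv : IsGasketInner n v) :
    gasketNbrSum (n + 1) g v = gasketNbrSum n g v := by
  have := hv.bounds
  rw [gasketNbrSum_succ, gasketNbrSum_of_notMem (v := v - ((2 : ℤ) ^ n, (0 : ℤ))),
    gasketNbrSum_of_notMem (v := v - ((0 : ℤ), (2 : ℤ) ^ n)), add_zero, add_zero] <;>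
  · refine notMem_gasketVerts ?_
    simp only [Prod.fst_sub, Prod.snd_sub]; omega

theorem gasketNbrSum_succ_right {n : ℕ} (g : ℤ × ℤ → ℤ) {v : ℤ × ℤ} (hv : IsGasketInner n v) :
    gasketNbrSum (n + 1) g (v + ((2 : ℤ) ^ n, (0 : ℤ))) =
      gasketNbrSum n (fun w => g (w + ((2 : ℤ) ^ n, (0 : ℤ)))) v := by
  have := hv.bounds
  rw [gasketNbrSum_succ, gasketNbrSum_of_notMem (v := v + ((2 : ℤ) ^ n, (0 : ℤ))),
    gasketNbrSum_of_notMem (v := v + ((2 : ℤ) ^ n, (0 : ℤ)) - ((0 : ℤ), (2 : ℤ) ^ n)),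
    add_zero, zero_add, add_sub_cancel_right] <;>
  · refine notMem_gasketVerts ?_
    simp only [Prod.fst_sub, Prod.snd_sub, Prod.fst_add, Prod.snd_add]; omega

theorem gasketNbrSum_succ_top {n : ℕ} (g : ℤ × ℤ → ℤ) {v : ℤ × ℤ} (hv : IsGasketInner n v) :
    gasketNbrSum (n + 1) g (v + ((0 : ℤ), (2 : ℤ) ^ n)) =
      gasketNbrSum n (fun w => g (w + ((0 : ℤ), (2 : ℤ) ^ n))) v := by
  have := hv.bounds
  rw [gasketNbrSum_succ, gasketNbrSum_of_notMem (v := v + ((0 : ℤ), (2 : ℤ) ^ n)),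
    gasketNbrSum_of_notMem (v := v + ((0 : ℤ), (2 : ℤ) ^ n) - ((2 : ℤ) ^ n, (0 : ℤ))),
    add_zero, zero_add, add_sub_cancel_right] <;>
  · refine notMem_gasketVerts ?_
    simp only [Prod.fst_sub, Prod.snd_sub, Prod.fst_add, Prod.snd_add]; omega

theorem gasketNbrSum_succ_corners (n : ℕ) (g : ℤ × ℤ → ℤ) :
    gasketNbrSum (n + 1) g (0, 0) = gasketNbrSum n g (0, 0) ∧
    gasketNbrSum (n + 1) g ((2 : ℤ) ^ (n + 1), (0 : ℤ)) =
      gasketNbrSum n (fun w => g (w + ((2 : ℤ) ^ n, (0 : ℤ)))) ((2 : ℤ) ^ n, (0 : ℤ)) ∧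
    gasketNbrSum (n + 1) g ((0 : ℤ), (2 : ℤ) ^ (n + 1)) =
      gasketNbrSum n (fun w => g (w + ((0 : ℤ), (2 : ℤ) ^ n))) ((0 : ℤ), (2 : ℤ) ^ n) := by
  have hN : (0 : ℤ) < 2 ^ n := by positivity
  have e : (2 : ℤ) ^ (n + 1) - 2 ^ n = 2 ^ n := by rw [pow_succ]; ring
  have e' : (2 : ℤ) ^ (n + 1) = 2 ^ n + 2 ^ n := by rw [pow_succ]; ring
  refine ⟨?_, ?_, ?_⟩
  · rw [gasketNbrSum_succ, gasketNbrSum_of_notMem (v := _ - ((2 : ℤ) ^ n, (0 : ℤ))),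
      gasketNbrSum_of_notMem (v := _ - ((0 : ℤ), (2 : ℤ) ^ n)), add_zero, add_zero] <;>
    · refine notMem_gasketVerts ?_
      simp only [Prod.fst_sub, Prod.snd_sub]; omega
  · rw [gasketNbrSum_succ, gasketNbrSum_of_notMem (v := (_, _)),
      gasketNbrSum_of_notMem (v := _ - ((0 : ℤ), (2 : ℤ) ^ n)), add_zero, zero_add,
      Prod.mk_sub_mk, e, sub_zero] <;>
    · refine notMem_gasketVerts ?_
      simp only [Prod.fst_sub, Prod.snd_sub]; omega
  · rw [gasketNbrSum_succ, gasketNbrSum_of_notMem (v := (_, _)),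
      gasketNbrSum_of_notMem (v := _ - ((2 : ℤ) ^ n, (0 : ℤ))), add_zero, zero_add,
      Prod.mk_sub_mk, e, sub_zero] <;>
    · refine notMem_gasketVerts ?_
      simp only [Prod.fst_sub, Prod.snd_sub]; omega

/-- Each junction point is a corner of exactly two copies. -/
theorem gasketNbrSum_succ_junctions (n : ℕ) (g : ℤ × ℤ → ℤ) :
    gasketNbrSum (n + 1) g ((2 : ℤ) ^ n, (0 : ℤ)) = gasketNbrSum n g ((2 : ℤ) ^ n, (0 : ℤ)) +
      gasketNbrSum n (fun w => g (w + ((2 : ℤ) ^ n, (0 : ℤ)))) (0, 0) ∧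
    gasketNbrSum (n + 1) g ((0 : ℤ), (2 : ℤ) ^ n) = gasketNbrSum n g ((0 : ℤ), (2 : ℤ) ^ n) +
      gasketNbrSum n (fun w => g (w + ((0 : ℤ), (2 : ℤ) ^ n))) (0, 0) ∧
    gasketNbrSum (n + 1) g ((2 : ℤ) ^ n, (2 : ℤ) ^ n) =
      gasketNbrSum n (fun w => g (w + ((2 : ℤ) ^ n, (0 : ℤ)))) ((0 : ℤ), (2 : ℤ) ^ n) +
      gasketNbrSum n (fun w => g (w + ((0 : ℤ), (2 : ℤ) ^ n))) ((2 : ℤ) ^ n, (0 : ℤ)) := by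
  have hN : (0 : ℤ) < 2 ^ n := by positivity
  refine ⟨?_, ?_, ?_⟩
  · rw [gasketNbrSum_succ, gasketNbrSum_of_notMem (v := _ - ((0 : ℤ), (2 : ℤ) ^ n)), add_zero,
      Prod.mk_sub_mk, sub_self, sub_zero]
    refine notMem_gasketVerts ?_
    simp only [Prod.fst_sub, Prod.snd_sub]; omega
  · rw [gasketNbrSum_succ, gasketNbrSum_of_notMem (v := _ - ((2 : ℤ) ^ n, (0 : ℤ))), add_zero,
      Prod.mk_sub_mk, sub_self, sub_self]
    refine notMem_gasketVerts ?_
    simp only [Prod.fst_sub, Prod.snd_sub]; omega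
  · rw [gasketNbrSum_succ, gasketNbrSum_of_notMem (v := (_, _)), zero_add,
      Prod.mk_sub_mk, Prod.mk_sub_mk, sub_self, sub_zero]
    refine notMem_gasketVerts ?_
    dsimp only; omega

/-- The degrees in `G_n` without the sink: `2` at the corners and `4` elsewhere. -/
theorem gasketNbrSum_one (n : ℕ) : gasketNbrSum n (fun _ => 1) (0, 0) = 2 ∧
    gasketNbrSum n (fun _ => 1) ((2 : ℤ) ^ n, (0 : ℤ)) = 2 ∧
    gasketNbrSum n (fun _ => 1) ((0 : ℤ), (2 : ℤ) ^ n) = 2 ∧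
    ∀ v, IsGasketInner n v → gasketNbrSum n (fun _ => 1) v = 4 := by
  induction n with
  | zero =>
    refine ⟨?_, ?_, ?_, fun v hv => absurd hv (not_isGasketInner_zero v)⟩ <;>
      decide
  | succ n ih =>
    obtain ⟨i0, i1, i2, i3⟩ := ih
    obtain ⟨c0, c1, c2⟩ := gasketNbrSum_succ_corners n (fun _ => 1)
    obtain ⟨j0, j1, j2⟩ := gasketNbrSum_succ_junctions n (fun _ => 1)
    refine ⟨c0.trans i0, c1.trans i1, c2.trans i2, fun v hv => ?_⟩
    refine hv.succ_cases (P := fun v => gasketNbrSum (n + 1) (fun _ => 1) v = 4) ?_ ?_ ?_ ?_ ?_ ?_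
    · exact fun v hv => (gasketNbrSum_succ_left _ hv).trans (i3 v hv)
    · exact fun v hv => (gasketNbrSum_succ_right _ hv).trans (i3 v hv)
    · exact fun v hv => (gasketNbrSum_succ_top _ hv).trans (i3 v hv)
    · rw [j0, i0, i1]; rfl
    · rw [j1, i0, i2]; rfl
    · rw [j2, i2, i1]; rfl

/-! ### Rotations of the gasket -/

/-- The clockwise rotation of `G_{n+1}` sends the lower left copy to the upper one, the upper to the
lower right and the lower right to the lower left, acting on each by the rotation of `G_n`; these
are the identities `e1`, `e3`, `e2`. -/
theorem rotCW_mem_iff (n : ℕ) : ∀ v, rotCW n v ∈ gasketVerts n ↔ v ∈ gasketVerts n := by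
  induction n with
  | zero =>
    rintro ⟨a, b⟩
    simp only [rotCW, gasketVerts, Finset.mem_insert, Finset.mem_singleton, Prod.mk.injEq]
    omega
  | succ n ih =>
    intro v
    have mem : ∀ v, v ∈ gasketVerts (n + 1) ↔ v ∈ gasketVerts n ∨
        v - ((2 : ℤ) ^ n, (0 : ℤ)) ∈ gasketVerts n ∨
        v - ((0 : ℤ), (2 : ℤ) ^ n) ∈ gasketVerts n := fun v => by
      rw [mem_gasketVerts_succ_iff]
      simp only [← sub_eq_iff_eq_add, exists_eq_right']
    obtain ⟨a, b⟩ := v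
    rw [mem, mem, ← ih (a, b), ← ih ((a, b) - _), ← ih ((a, b) - _)]
    have e1 : rotCW (n + 1) (a, b) - ((0 : ℤ), (2 : ℤ) ^ n) = rotCW n (a, b) := by
      simp only [rotCW, pow_succ]; ext <;> simp; ring
    have e2 : rotCW (n + 1) (a, b) = rotCW n ((a, b) - ((2 : ℤ) ^ n, (0 : ℤ))) := by
      simp only [rotCW, pow_succ]; ext <;> simp; ring
    have e3 : rotCW (n + 1) (a, b) - ((2 : ℤ) ^ n, (0 : ℤ)) =
        rotCW n ((a, b) - ((0 : ℤ), (2 : ℤ) ^ n)) := by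
      simp only [rotCW, pow_succ]; ext <;> simp; ring
    rw [e1, e3, e2]
    tauto

theorem rotCW_gasketAdj_iff (n : ℕ) :
    ∀ v w, gasketAdj n (rotCW n v) (rotCW n w) ↔ gasketAdj n v w := by
  induction n with
  | zero =>
    intro v w
    simp only [gasketAdj, rotCW_mem_iff 0]
    have : rotCW 0 v = rotCW 0 w ↔ v = w := by
      obtain ⟨a, b⟩ := v
      obtain ⟨c, d⟩ := w
      simp only [rotCW, Prod.mk.injEq]; omega
    rw [ne_eq, this]
  | succ n ih =>
    have e1 : ∀ v, rotCW (n + 1) v - ((0 : ℤ), (2 : ℤ) ^ n) = rotCW n v := fun v => by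
      simp only [rotCW, pow_succ]; ext <;> simp; ring
    have e2 : ∀ v, rotCW (n + 1) v = rotCW n (v - ((2 : ℤ) ^ n, (0 : ℤ))) := fun v => by
      simp only [rotCW, pow_succ]; ext <;> simp; ring
    have e3 : ∀ v, rotCW (n + 1) v - ((2 : ℤ) ^ n, (0 : ℤ)) =
        rotCW n (v - ((0 : ℤ), (2 : ℤ) ^ n)) := fun v => by
      simp only [rotCW, pow_succ]; ext <;> simp; ring
    intro v w
    simp only [gasketAdj]
    rw [e1, e3, e1, e3, e2, e2, ih, ih, ih]
    tauto

theorem rotCW_rotCCW (n : ℕ) (v : ℤ × ℤ) : rotCW n (rotCCW n v) = v := by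
  simp only [rotCW, rotCCW]; ext <;> simp only; ring

theorem rotCCW_rotCW (n : ℕ) (v : ℤ × ℤ) : rotCCW n (rotCW n v) = v := by
  simp only [rotCW, rotCCW]; ext <;> simp only; ring

theorem rotCCW_mem_iff (n : ℕ) (v : ℤ × ℤ) : rotCCW n v ∈ gasketVerts n ↔ v ∈ gasketVerts n := by
  rw [← rotCW_mem_iff, rotCW_rotCCW]

theorem gasketNbrSum_rotCW (n : ℕ) (g : ℤ × ℤ → ℤ) (v : ℤ × ℤ) :
    gasketNbrSum n (fun w => g (rotCW n w)) v = gasketNbrSum n g (rotCW n v) := by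
  unfold gasketNbrSum
  refine Finset.sum_nbij' (rotCW n) (rotCCW n) (fun w hw => (rotCW_mem_iff n w).2 hw)
    (fun w hw => (rotCCW_mem_iff n w).2 hw) (fun w _ => rotCCW_rotCW n w)
    (fun w _ => rotCW_rotCCW n w) fun w _ => ?_
  simp only [rotCW_gasketAdj_iff]

theorem gasketNbrSum_rotCCW (n : ℕ) (g : ℤ × ℤ → ℤ) (v : ℤ × ℤ) :
    gasketNbrSum n (fun w => g (rotCCW n w)) v = gasketNbrSum n g (rotCCW n v) := by
  have := gasketNbrSum_rotCW n (fun w => g (rotCCW n w)) (rotCCW n v)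
  simp only [rotCCW_rotCW, rotCW_rotCCW] at this
  exact this.symm

theorem IsGasketInner.rotCW {n : ℕ} {v : ℤ × ℤ} (h : IsGasketInner n v) :
    IsGasketInner n (rotCW n v) := by
  have hb := h.bounds
  refine ⟨(rotCW_mem_iff n v).2 h.1, ?_, ?_, ?_⟩ <;>
  · simp only [_root_.rotCW, ne_eq, Prod.mk.injEq]
    omega

theorem IsGasketInner.rotCCW {n : ℕ} {v : ℤ × ℤ} (h : IsGasketInner n v) :
    IsGasketInner n (rotCCW n v) := by
  have hb := h.bounds
  refine ⟨(rotCCW_mem_iff n v).2 h.1, ?_, ?_, ?_⟩ <;>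
  · simp only [_root_.rotCCW, ne_eq, Prod.mk.injEq]
    omega

theorem IsGasketInner.succ {n : ℕ} {v : ℤ × ℤ} (h : IsGasketInner n v) :
    IsGasketInner (n + 1) v ∧ IsGasketInner (n + 1) (v + ((2 : ℤ) ^ n, (0 : ℤ))) ∧
      IsGasketInner (n + 1) (v + ((0 : ℤ), (2 : ℤ) ^ n)) := by
  have hb := h.bounds
  refine ⟨⟨(mem_gasketVerts_succ_iff n _).2 (.inl h.1), ?_⟩,
    ⟨(mem_gasketVerts_succ_iff n _).2 (.inr (.inl ⟨v, h.1, rfl⟩)), ?_⟩,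
    ⟨(mem_gasketVerts_succ_iff n _).2 (.inr (.inr ⟨v, h.1, rfl⟩)), ?_⟩⟩ <;>
  · simp only [ne_eq, Prod.ext_iff, Prod.fst_add, Prod.snd_add, pow_succ]
    omega

theorem isGasketInner_junctions (n : ℕ) : IsGasketInner (n + 1) ((2 : ℤ) ^ n, (0 : ℤ)) ∧
    IsGasketInner (n + 1) ((0 : ℤ), (2 : ℤ) ^ n) ∧
    IsGasketInner (n + 1) ((2 : ℤ) ^ n, (2 : ℤ) ^ n) := by
  have hN : (0 : ℤ) < 2 ^ n := by positivity
  obtain ⟨-, c1, c2⟩ := gasketVerts_corners n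
  refine ⟨⟨(mem_gasketVerts_succ_iff n _).2 (.inl c1), ?_⟩,
    ⟨(mem_gasketVerts_succ_iff n _).2 (.inl c2), ?_⟩,
    ⟨(mem_gasketVerts_succ_iff n _).2 (.inr (.inl ⟨_, c2, by simp⟩)), ?_⟩⟩ <;>
  · simp only [ne_eq, Prod.mk.injEq, pow_succ]
    omega

theorem gasketM_junctions (n x y z : ℕ) : gasketM (n + 1) x y z ((2 : ℤ) ^ n, (0 : ℤ)) = 3 ∧
    gasketM (n + 1) x y z ((0 : ℤ), (2 : ℤ) ^ n) = 3 ∧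
    gasketM (n + 1) x y z ((2 : ℤ) ^ n, (2 : ℤ) ^ n) = 2 := by
  obtain ⟨-, c1, c2⟩ := gasketVerts_corners n
  refine ⟨(gasketM_restrict n x y z _ c1).1.trans (gasketM_corners n _ _ _).2.1,
    (gasketM_restrict n x y z _ c2).1.trans (gasketM_corners n _ _ _).2.2, ?_⟩
  have := (gasketM_restrict n x y z _ c2).2.1.trans (gasketM_corners n _ _ _).2.2
  simpa using this

/-- The upper bound gives stability, and the lower bound gives `2e ≥ η_max`. The corner values are
kept general because the recursion uses both 2 and 3 there. -/
theorem gasketM_mem_Icc (n : ℕ) {x y z : ℕ} (hx : x ∈ Set.Icc 2 3) (hy : y ∈ Set.Icc 2 3)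
    (hz : z ∈ Set.Icc 2 3) {v : ℤ × ℤ} (hv : v ∈ gasketVerts n) :
    gasketM n x y z v ∈ Set.Icc 2 3 := by
  induction n generalizing x y z v with
  | zero =>
    simp only [gasketVerts, Finset.mem_insert, Finset.mem_singleton] at hv
    rcases hv with rfl | rfl | rfl
    · exact hx
    · exact hy
    · exact hz
  | succ n ih =>
    have h2 : 2 ∈ Set.Icc 2 3 := by simp
    have h3 : 3 ∈ Set.Icc 2 3 := by simp
    rcases (mem_gasketVerts_succ_iff n v).1 hv with hw | ⟨w, hw, rfl⟩ | ⟨w, hw, rfl⟩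
    · rw [(gasketM_restrict n x y z v hw).1]; exact ih hx h3 h3 hw
    · rw [(gasketM_restrict n x y z w hw).2.1]; exact ih h3 hy h2 hw
    · rw [(gasketM_restrict n x y z w hw).2.2]; exact ih h3 h2 hz hw

/-! ### Burning -/

/-- Only the remaining third corner can still contribute. Corners are adjacent to each other only
when `n = 0`, but the bound 1 suffices for every `n`. -/
theorem gasketNbrSum_corner_le_one {n : ℕ} {χ : ℤ × ℤ → ℤ} (h1 : ∀ v, χ v ≤ 1)
    (h0 : χ (0, 0) = 0) (hin : ∀ v, IsGasketInner n v → χ v = 0) :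
    gasketNbrSum n χ ((2 : ℤ) ^ n, (0 : ℤ)) ≤ 1 ∧ gasketNbrSum n χ ((0 : ℤ), (2 : ℤ) ^ n) ≤ 1 := by
  have single : ∀ p v, gasketNbrSum n (fun w => if w = p then 1 else 0) v ≤ 1 := by
    intro p v
    calc gasketNbrSum n (fun w => if w = p then 1 else 0) v
        ≤ ∑ w ∈ gasketVerts n, if w = p then 1 else 0 :=
          Finset.sum_le_sum fun w _ => by dsimp only; split_ifs <;> simp
      _ ≤ 1 := by rw [Finset.sum_ite_eq']; split_ifs <;> simp
  constructor
  · refine (gasketNbrSum_mono n _ fun w hw ha => ?_).trans (single ((0 : ℤ), (2 : ℤ) ^ n) _)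
    rcases eq_corner_or_isGasketInner hw with rfl | rfl | rfl | hi
    · rw [h0]; split_ifs <;> simp
    · exact absurd ha (gasketAdj_irrefl n _)
    · simpa using h1 _
    · rw [hin w hi]; split_ifs <;> simp
  · refine (gasketNbrSum_mono n _ fun w hw ha => ?_).trans (single ((2 : ℤ) ^ n, (0 : ℤ)) _)
    rcases eq_corner_or_isGasketInner hw with rfl | rfl | rfl | hi
    · rw [h0]; split_ifs <;> simp
    · simpa using h1 _
    · exact absurd ha (gasketAdj_irrefl n _)
    · rw [hin w hi]; split_ifs <;> simp

theorem gasketNbrSum_corner_le_two (n : ℕ) {χ : ℤ × ℤ → ℤ} (h1 : ∀ v, χ v ≤ 1) :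
    gasketNbrSum n χ (0, 0) ≤ 2 ∧ gasketNbrSum n χ ((2 : ℤ) ^ n, (0 : ℤ)) ≤ 2 ∧
      gasketNbrSum n χ ((0 : ℤ), (2 : ℤ) ^ n) ≤ 2 := by
  obtain ⟨d0, d1, d2, -⟩ := gasketNbrSum_one n
  have hle := fun v => gasketNbrSum_mono n (g := χ) (g' := fun _ => 1) v fun w _ _ => h1 w
  exact ⟨(hle _).trans d0.le, (hle _).trans d1.le, (hle _).trans d2.le⟩

/-- The fire burns through `M_n(x, y, z)` once the lower left corner is burnt: `χ` is the
indicator function of the unburnt vertices. -/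
theorem gasketM_burn (n : ℕ) {χ : ℤ × ℤ → ℤ} (h1 : ∀ v, χ v ≤ 1) (h0 : χ (0, 0) = 0) (x y z : ℕ)
    (h : ∀ v, IsGasketInner n v → χ v ≠ 0 → (gasketM n x y z v : ℤ) < gasketNbrSum n χ v) :
    ∀ v, IsGasketInner n v → χ v = 0 := by
  induction n generalizing χ x y z with
  | zero => exact fun v hv => absurd hv (not_isGasketInner_zero v)
  | succ n ih =>
    obtain ⟨j0, j1, j2⟩ := gasketNbrSum_succ_junctions n χ
    obtain ⟨i0, i1, i2⟩ := isGasketInner_junctions n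
    obtain ⟨m0, m1, m2⟩ := gasketM_junctions n x y z
    have hl : ∀ v, IsGasketInner n v → χ v = 0 := ih h1 h0 x 3 3 fun v hv hne => by
      have := h v hv.succ.1 hne
      rwa [(gasketM_restrict n x y z v hv.1).1, gasketNbrSum_succ_left _ hv] at this
    -- The junctions on the lower left copy now have at most one unburnt neighbour inside it and at
    -- most two in the next copy, so their value 3 lets them burn. They are the lower left corners
    -- of the other copies, where the induction hypothesis applies again.
    obtain ⟨b1, b2⟩ := gasketNbrSum_corner_le_one h1 h0 hl
    have hlr : χ ((2 : ℤ) ^ n, (0 : ℤ)) = 0 := by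
      by_contra hne
      have := h _ i0 hne
      rw [m0, j0] at this
      have := (gasketNbrSum_corner_le_two n
        (χ := fun w => χ (w + ((2 : ℤ) ^ n, (0 : ℤ)))) fun v => h1 _).1
      push_cast at *
      omega
    have hlt : χ ((0 : ℤ), (2 : ℤ) ^ n) = 0 := by
      by_contra hne
      have := h _ i1 hne
      rw [m1, j1] at this
      have := (gasketNbrSum_corner_le_two n
        (χ := fun w => χ (w + ((0 : ℤ), (2 : ℤ) ^ n))) fun v => h1 _).1
      push_cast at *
      omega
    have hr : ∀ v, IsGasketInner n v → χ (v + ((2 : ℤ) ^ n, (0 : ℤ))) = 0 :=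
      ih (χ := fun w => χ (w + ((2 : ℤ) ^ n, (0 : ℤ)))) (fun v => h1 _) (by simpa using hlr) 3 y 2
        fun v hv hne => by
          have := h _ hv.succ.2.1 hne
          rwa [(gasketM_restrict n x y z v hv.1).2.1, gasketNbrSum_succ_right _ hv] at this
    have ht : ∀ v, IsGasketInner n v → χ (v + ((0 : ℤ), (2 : ℤ) ^ n)) = 0 :=
      ih (χ := fun w => χ (w + ((0 : ℤ), (2 : ℤ) ^ n))) (fun v => h1 _) (by simpa using hlt) 3 2 z
        fun v hv hne => by
          have := h _ hv.succ.2.2 hne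
          rwa [(gasketM_restrict n x y z v hv.1).2.2, gasketNbrSum_succ_top _ hv] at this
    have br := (gasketNbrSum_corner_le_one
      (χ := fun w => χ (w + ((2 : ℤ) ^ n, (0 : ℤ)))) (fun v => h1 _) (by simpa using hlr) hr).2
    have bt := (gasketNbrSum_corner_le_one
      (χ := fun w => χ (w + ((0 : ℤ), (2 : ℤ) ^ n))) (fun v => h1 _) (by simpa using hlt) ht).1
    -- Each of the two burnt copies leaves at most one unburnt neighbour here, which the value 2
    -- matches.
    have hrt : χ ((2 : ℤ) ^ n, (2 : ℤ) ^ n) = 0 := by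
      by_contra hne
      have := h _ i2 hne
      rw [m2, j2] at this
      push_cast at *
      omega
    exact fun v hv => hv.succ_cases (P := fun v => χ v = 0) hl hr ht hlr hlt hrt

/-! ### The Laplacian of the gasket without sink -/

/-- The Laplacian of the graph `G_n` without the sink. -/
def gasketLap (n : ℕ) (f : ℤ × ℤ → ℤ) (v : ℤ × ℤ) : ℤ :=
  gasketNbrSum n (fun w => f v - f w) v

theorem gasketLap_add (n : ℕ) (f g : ℤ × ℤ → ℤ) (c : ℤ) (v : ℤ × ℤ) :
    gasketLap n (fun w => f w + g w + c) v = gasketLap n f v + gasketLap n g v := by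
  unfold gasketLap
  rw [← gasketNbrSum_add]
  exact gasketNbrSum_congr v fun w _ => by ring

theorem gasketLap_add_const (n : ℕ) (f : ℤ × ℤ → ℤ) (c : ℤ) (v : ℤ × ℤ) :
    gasketLap n (fun w => f w + c) v = gasketLap n f v :=
  gasketNbrSum_congr v fun w _ => by ring

theorem gasketLap_rotCW (n : ℕ) (f : ℤ × ℤ → ℤ) (v : ℤ × ℤ) :
    gasketLap n (fun w => f (rotCW n w)) v = gasketLap n f (rotCW n v) :=
  gasketNbrSum_rotCW n (fun w => f (rotCW n v) - f w) v

theorem gasketLap_rotCCW (n : ℕ) (f : ℤ × ℤ → ℤ) (v : ℤ × ℤ) :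
    gasketLap n (fun w => f (rotCCW n w)) v = gasketLap n f (rotCCW n v) :=
  gasketNbrSum_rotCCW n (fun w => f (rotCCW n v) - f w) v

/-- `F` restricts to `f`, `g`, `h` on the lower left, lower right and upper copy of `G_n`. -/
structure IsGasketGlue (n : ℕ) (f g h F : ℤ × ℤ → ℤ) : Prop where
  left : ∀ v ∈ gasketVerts n, F v = f v
  right : ∀ v ∈ gasketVerts n, F (v + ((2 : ℤ) ^ n, (0 : ℤ))) = g v
  top : ∀ v ∈ gasketVerts n, F (v + ((0 : ℤ), (2 : ℤ) ^ n)) = h v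

/-- The copies overlap only in the junction points, where the three equalities make the order of the
cases immaterial. -/
theorem exists_isGasketGlue (n : ℕ) (f g h : ℤ × ℤ → ℤ)
    (hfg : f ((2 : ℤ) ^ n, (0 : ℤ)) = g (0, 0)) (hfh : f ((0 : ℤ), (2 : ℤ) ^ n) = h (0, 0))
    (hgh : g ((0 : ℤ), (2 : ℤ) ^ n) = h ((2 : ℤ) ^ n, (0 : ℤ))) :
    ∃ F, IsGasketGlue n f g h F := by
  refine ⟨fun v => if v ∈ gasketVerts n then f v
    else if v - ((2 : ℤ) ^ n, (0 : ℤ)) ∈ gasketVerts n then g (v - ((2 : ℤ) ^ n, (0 : ℤ)))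
    else h (v - ((0 : ℤ), (2 : ℤ) ^ n)), fun v hv => if_pos hv, fun v hv => ?_, fun v hv => ?_⟩
  · by_cases hl : v + ((2 : ℤ) ^ n, (0 : ℤ)) ∈ gasketVerts n
    · have h1 := gasketVerts_bounds n _ hl
      have h2 := gasketVerts_bounds n _ hv
      simp only [Prod.fst_add, Prod.snd_add] at h1
      have : v = (0, 0) := by ext <;> simp only <;> omega
      subst this
      rw [if_pos hl, ← hfg]
      simp
    · simp [hl, hv]
  · have h2 := gasketVerts_bounds n _ hv
    by_cases hl : v + ((0 : ℤ), (2 : ℤ) ^ n) ∈ gasketVerts n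
    · have h1 := gasketVerts_bounds n _ hl
      simp only [Prod.fst_add, Prod.snd_add] at h1
      have : v = (0, 0) := by ext <;> simp only <;> omega
      subst this
      rw [if_pos hl, ← hfh]
      simp
    · by_cases hr : v + ((0 : ℤ), (2 : ℤ) ^ n) - ((2 : ℤ) ^ n, (0 : ℤ)) ∈ gasketVerts n
      · have h1 := gasketVerts_bounds n _ hr
        simp only [Prod.fst_add, Prod.snd_add, Prod.fst_sub, Prod.snd_sub] at h1
        have : v = ((2 : ℤ) ^ n, (0 : ℤ)) := by ext <;> simp only <;> omega
        subst this
        simp only [if_neg hl, if_pos hr, ← hgh]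
        congr 1
        ext <;> simp
      · simp [hl, hr]

namespace IsGasketGlue

variable {n : ℕ} {f g h F : ℤ × ℤ → ℤ}

theorem corners (hF : IsGasketGlue n f g h F) : F (0, 0) = f (0, 0) ∧
    F ((2 : ℤ) ^ (n + 1), (0 : ℤ)) = g ((2 : ℤ) ^ n, (0 : ℤ)) ∧
    F ((0 : ℤ), (2 : ℤ) ^ (n + 1)) = h ((0 : ℤ), (2 : ℤ) ^ n) := by
  obtain ⟨c0, c1, c2⟩ := gasketVerts_corners n
  have e1 := hF.right _ c1
  have e2 := hF.top _ c2
  rw [Prod.mk_add_mk, add_zero, ← mul_two, ← pow_succ] at e1 e2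
  exact ⟨hF.left _ c0, e1, e2⟩

/-- The central value is a parameter `a`, so that the same lemma serves inner vertices, corners and
junctions, where that value is written differently. -/
theorem nbrSum_left (hF : IsGasketGlue n f g h F) {v : ℤ × ℤ} {a : ℤ}
    (ha : a = f v) : gasketNbrSum n (fun w => a - F w) v = gasketLap n f v :=
  gasketNbrSum_congr v fun w hw => by rw [ha, hF.left w hw]

theorem nbrSum_right (hF : IsGasketGlue n f g h F) {v : ℤ × ℤ} {a : ℤ}
    (ha : a = g v) :
    gasketNbrSum n (fun w => a - F (w + ((2 : ℤ) ^ n, (0 : ℤ)))) v = gasketLap n g v :=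
  gasketNbrSum_congr v fun w hw => by rw [ha, hF.right w hw]

theorem nbrSum_top (hF : IsGasketGlue n f g h F) {v : ℤ × ℤ} {a : ℤ}
    (ha : a = h v) :
    gasketNbrSum n (fun w => a - F (w + ((0 : ℤ), (2 : ℤ) ^ n))) v = gasketLap n h v :=
  gasketNbrSum_congr v fun w hw => by rw [ha, hF.top w hw]

theorem lap_left (hF : IsGasketGlue n f g h F) {v : ℤ × ℤ} (hv : IsGasketInner n v) :
    gasketLap (n + 1) F v = gasketLap n f v :=
  (gasketNbrSum_succ_left _ hv).trans (hF.nbrSum_left (hF.left v hv.1))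

theorem lap_right (hF : IsGasketGlue n f g h F) {v : ℤ × ℤ} (hv : IsGasketInner n v) :
    gasketLap (n + 1) F (v + ((2 : ℤ) ^ n, (0 : ℤ))) = gasketLap n g v :=
  (gasketNbrSum_succ_right _ hv).trans (hF.nbrSum_right (hF.right v hv.1))

theorem lap_top (hF : IsGasketGlue n f g h F) {v : ℤ × ℤ} (hv : IsGasketInner n v) :
    gasketLap (n + 1) F (v + ((0 : ℤ), (2 : ℤ) ^ n)) = gasketLap n h v :=
  (gasketNbrSum_succ_top _ hv).trans (hF.nbrSum_top (hF.top v hv.1))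

theorem lap_corners (hF : IsGasketGlue n f g h F) :
    gasketLap (n + 1) F (0, 0) = gasketLap n f (0, 0) ∧
    gasketLap (n + 1) F ((2 : ℤ) ^ (n + 1), (0 : ℤ)) = gasketLap n g ((2 : ℤ) ^ n, (0 : ℤ)) ∧
    gasketLap (n + 1) F ((0 : ℤ), (2 : ℤ) ^ (n + 1)) = gasketLap n h ((0 : ℤ), (2 : ℤ) ^ n) :=
  ⟨(gasketNbrSum_succ_corners n _).1.trans (hF.nbrSum_left hF.corners.1),
    (gasketNbrSum_succ_corners n _).2.1.trans (hF.nbrSum_right hF.corners.2.1),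
    (gasketNbrSum_succ_corners n _).2.2.trans (hF.nbrSum_top hF.corners.2.2)⟩

theorem lap_junctions (hF : IsGasketGlue n f g h F) :
    gasketLap (n + 1) F ((2 : ℤ) ^ n, (0 : ℤ)) =
      gasketLap n f ((2 : ℤ) ^ n, (0 : ℤ)) + gasketLap n g (0, 0) ∧
    gasketLap (n + 1) F ((0 : ℤ), (2 : ℤ) ^ n) =
      gasketLap n f ((0 : ℤ), (2 : ℤ) ^ n) + gasketLap n h (0, 0) ∧
    gasketLap (n + 1) F ((2 : ℤ) ^ n, (2 : ℤ) ^ n) =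
      gasketLap n g ((0 : ℤ), (2 : ℤ) ^ n) + gasketLap n h ((2 : ℤ) ^ n, (0 : ℤ)) := by
  obtain ⟨c0, c1, c2⟩ := gasketVerts_corners n
  refine ⟨(gasketNbrSum_succ_junctions n _).1.trans ?_,
    (gasketNbrSum_succ_junctions n _).2.1.trans ?_,
    (gasketNbrSum_succ_junctions n _).2.2.trans ?_⟩
  · rw [hF.nbrSum_left (hF.left _ c1), hF.nbrSum_right (by simpa using hF.right _ c0)]
  · rw [hF.nbrSum_left (hF.left _ c2), hF.nbrSum_top (by simpa using hF.top _ c0)]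
  · rw [hF.nbrSum_right (by simpa using hF.right _ c2),
      hF.nbrSum_top (by simpa using hF.top _ c1)]

end IsGasketGlue

/-! ### Harmonic functions and the potential of `M_n`. -/

/-- Integer harmonic functions on the gasket with prescribed corner values. -/
theorem exists_gasket_harmonic (n : ℕ) (a b c : ℤ) : ∃ F : ℤ × ℤ → ℤ,
    F (0, 0) = 5 ^ n * a ∧ F ((2 : ℤ) ^ n, (0 : ℤ)) = 5 ^ n * b ∧
    F ((0 : ℤ), (2 : ℤ) ^ n) = 5 ^ n * c ∧
    gasketLap n F (0, 0) = 3 ^ n * (2 * a - b - c) ∧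
    gasketLap n F ((2 : ℤ) ^ n, (0 : ℤ)) = 3 ^ n * (2 * b - a - c) ∧
    gasketLap n F ((0 : ℤ), (2 : ℤ) ^ n) = 3 ^ n * (2 * c - a - b) ∧
    ∀ v, IsGasketInner n v → gasketLap n F v = 0 := by
  induction n generalizing a b c with
  | zero =>
    refine ⟨fun v => if v = (0, 0) then a else if v = (1, 0) then b else c, ?_⟩
    have nbr : ∀ g : ℤ × ℤ → ℤ, gasketNbrSum 0 g (0, 0) = g (1, 0) + g (0, 1) ∧
        gasketNbrSum 0 g (1, 0) = g (0, 0) + g (0, 1) ∧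
        gasketNbrSum 0 g (0, 1) = g (0, 0) + g (1, 0) := by
      intro g
      refine ⟨?_, ?_, ?_⟩ <;> simp [gasketNbrSum, gasketVerts, gasketAdj]
    simp only [gasketLap, pow_zero, (nbr _).1, (nbr _).2.1, (nbr _).2.2]
    refine ⟨by simp, by simp, by simp, ?_, ?_, ?_, fun v hv =>
      absurd hv (not_isGasketInner_zero v)⟩ <;> simp <;> ring
  | succ n ih =>
    -- The 1/5–2/5 rule: harmonicity gives the junction between the corners with values `a` and `b`
    -- the value `(2a + 2b + c) / 5`. One factor of `5 ^ (n + 1)` absorbs the denominator.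
    obtain ⟨f, f0, f1, f2, g0, g1, g2, hf⟩ := ih (5 * a) (2 * a + 2 * b + c) (2 * a + b + 2 * c)
    obtain ⟨f', f0', f1', f2', g0', g1', g2', hf'⟩ :=
      ih (2 * a + 2 * b + c) (5 * b) (a + 2 * b + 2 * c)
    obtain ⟨f'', f0'', f1'', f2'', g0'', g1'', g2'', hf''⟩ :=
      ih (2 * a + b + 2 * c) (a + 2 * b + 2 * c) (5 * c)
    obtain ⟨F, hF⟩ := exists_isGasketGlue n f f' f'' (f1.trans f0'.symm) (f2.trans f0''.symm)
      (f2'.trans f1''.symm)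
    obtain ⟨c0, c1, c2⟩ := hF.corners
    obtain ⟨l0, l1, l2⟩ := hF.lap_corners
    obtain ⟨j0, j1, j2⟩ := hF.lap_junctions
    refine ⟨F, by rw [c0, f0]; ring, by rw [c1, f1']; ring, by rw [c2, f2'']; ring,
      by rw [l0, g0]; ring, by rw [l1, g1']; ring, by rw [l2, g2'']; ring, fun v hv =>
        hv.succ_cases (P := fun v => gasketLap (n + 1) F v = 0)
          (fun v hv => (hF.lap_left hv).trans (hf v hv))
          (fun v hv => (hF.lap_right hv).trans (hf' v hv))
          (fun v hv => (hF.lap_top hv).trans (hf'' v hv)) ?_ ?_ ?_⟩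
    · rw [j0, g1, g0']; ring
    · rw [j1, g2, g0'']; ring
    · rw [j2, g2', g1'']; ring

/-- An integer function on `G_n` with Laplacian `M_n(x, y, z)` away from the corners. -/
theorem exists_gasketLap_eq_gasketM (n : ℕ) : ∃ (F : ℤ × ℤ → ℤ) (p : ℤ),
    F (0, 0) = p ∧ F ((2 : ℤ) ^ n, (0 : ℤ)) = 0 ∧ F ((0 : ℤ), (2 : ℤ) ^ n) = 0 ∧
    gasketLap n F (0, 0) = 2 - 4 * 3 ^ n ∧
    gasketLap n F ((2 : ℤ) ^ n, (0 : ℤ)) = 1 ∧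
    gasketLap n F ((0 : ℤ), (2 : ℤ) ^ n) = 1 ∧
    ∀ v, IsGasketInner n v → ∀ x y z, gasketLap n F v = gasketM n x y z v := by
  induction n with
  | zero =>
    -- On the triangle the corner values -1, 0, 0 give the Laplacians -2, 1, 1, and `2 - 4 * 3 ^ 0 =
    -- -2`.
    obtain ⟨F, f0, f1, f2, g0, g1, g2, -⟩ := exists_gasket_harmonic 0 (-1) 0 0
    exact ⟨F, -1, by simpa using f0, by simpa using f1, by simpa using f2, by simpa using g0,
      by simpa using g1, by simpa using g2, fun v hv => absurd hv (not_isGasketInner_zero v)⟩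
  | succ n ih =>
    obtain ⟨f, p, f0, f1, f2, g0, g1, g2, hf⟩ := ih
    -- The value -4 makes `H` contribute `4 * 3 ^ n` at each of the two junctions on the lower left
    -- copy, cancelling the `-4 * 3 ^ n` of the next copy's lower left corner: `1 + 4 * 3 ^ n + (2 -
    -- 4 * 3 ^ n) = 3`. The third junction gets `1 + 1 = 2`. Adding `p` below makes the values agree
    -- at the junctions.
    obtain ⟨H, h0, h1, h2, k0, k1, k2, hH⟩ := exists_gasket_harmonic n (-4) 0 0
    obtain ⟨F, hF⟩ := exists_isGasketGlue n (fun v => f v + H v + p) f f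
      (by rw [f1, h1, f0]; ring) (by rw [f2, h2, f0]; ring) (f2.trans f1.symm)
    obtain ⟨c0, c1, c2⟩ := hF.corners
    obtain ⟨l0, l1, l2⟩ := hF.lap_corners
    obtain ⟨j0, j1, j2⟩ := hF.lap_junctions
    refine ⟨F, p + 5 ^ n * (-4) + p, by rw [c0, f0, h0], c1.trans f1, c2.trans f2,
      by rw [l0, gasketLap_add, g0, k0]; ring, l1.trans g1, l2.trans g2, fun v hv x y z =>
        hv.succ_cases (P := fun v => gasketLap (n + 1) F v = gasketM (n + 1) x y z v)
          (fun v hv => ?_) (fun v hv => ?_) (fun v hv => ?_) ?_ ?_ ?_⟩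
    · rw [hF.lap_left hv, gasketLap_add, hH v hv, (gasketM_restrict n x y z v hv.1).1, add_zero]
      exact hf v hv _ _ _
    · rw [hF.lap_right hv, (gasketM_restrict n x y z v hv.1).2.1]
      exact hf v hv _ _ _
    · rw [hF.lap_top hv, (gasketM_restrict n x y z v hv.1).2.2]
      exact hf v hv _ _ _
    · rw [j0, gasketLap_add, g1, k1, g0, (gasketM_junctions n x y z).1]; push_cast; ring
    · rw [j1, gasketLap_add, g2, k2, g0, (gasketM_junctions n x y z).2.1]; push_cast; ring
    · rw [j2, g2, g1, (gasketM_junctions n x y z).2.2]; rfl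

/-! ### The identity configuration -/

theorem rot_corners (n : ℕ) : rotCW n (0, 0) = ((0 : ℤ), (2 : ℤ) ^ n) ∧
    rotCW n ((2 : ℤ) ^ n, (0 : ℤ)) = (0, 0) ∧
    rotCW n ((0 : ℤ), (2 : ℤ) ^ n) = ((2 : ℤ) ^ n, (0 : ℤ)) ∧
    rotCCW n (0, 0) = ((2 : ℤ) ^ n, (0 : ℤ)) ∧
    rotCCW n ((2 : ℤ) ^ n, (0 : ℤ)) = ((0 : ℤ), (2 : ℤ) ^ n) ∧
    rotCCW n ((0 : ℤ), (2 : ℤ) ^ n) = (0, 0) := by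
  simp [rotCW, rotCCW]

/-- The function on `ℤ × ℤ` underlying `gasketIdConfig n`. -/
def gasketIdFun (n : ℕ) : ℤ × ℤ → ℕ :=
  gasketMatch n (gasketM n 2 2 2) (rotPlus n (gasketM n 2 2 2)) (rotMinus n (gasketM n 2 2 2))

theorem gasketIdFun_restrict (n : ℕ) (v : ℤ × ℤ) (hv : v ∈ gasketVerts n) :
    gasketIdFun n v = gasketM n 2 2 2 v ∧
    gasketIdFun n (v + ((2 : ℤ) ^ n, (0 : ℤ))) = gasketM n 2 2 2 (rotCW n v) ∧
    gasketIdFun n (v + ((0 : ℤ), (2 : ℤ) ^ n)) = gasketM n 2 2 2 (rotCCW n v) := by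
  obtain ⟨_, c1, c2⟩ := gasketM_corners n 2 2 2
  exact ⟨gasketMatch_left n _ _ _ v hv,
    gasketMatch_right n _ _ _ (by simp [rotPlus, rotCW, c1, c2]) v hv,
    gasketMatch_top n _ _ _ (by simp [rotMinus, rotCCW, c1, c2])
      (by simp [rotPlus, rotMinus, rotCW, rotCCW, c1, c2]) v hv⟩

theorem gasketIdFun_special (n : ℕ) : gasketIdFun n (0, 0) = 2 ∧
    gasketIdFun n ((2 : ℤ) ^ (n + 1), (0 : ℤ)) = 2 ∧
    gasketIdFun n ((0 : ℤ), (2 : ℤ) ^ (n + 1)) = 2 ∧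
    gasketIdFun n ((2 : ℤ) ^ n, (0 : ℤ)) = 2 ∧ gasketIdFun n ((0 : ℤ), (2 : ℤ) ^ n) = 2 ∧
    gasketIdFun n ((2 : ℤ) ^ n, (2 : ℤ) ^ n) = 2 := by
  obtain ⟨c0, c1, c2⟩ := gasketVerts_corners n
  obtain ⟨m0, m1, m2⟩ := gasketM_corners n 2 2 2
  obtain ⟨r0, r1, r2, s0, s1, s2⟩ := rot_corners n
  refine ⟨(gasketIdFun_restrict n _ c0).1.trans m0, ?_, ?_,
    (gasketIdFun_restrict n _ c1).1.trans m1, (gasketIdFun_restrict n _ c2).1.trans m2, ?_⟩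
  · have := (gasketIdFun_restrict n _ c1).2.1
    rwa [r1, m0, Prod.mk_add_mk, add_zero, ← mul_two, ← pow_succ] at this
  · have := (gasketIdFun_restrict n _ c2).2.2
    rwa [s2, m0, Prod.mk_add_mk, add_zero, ← mul_two, ← pow_succ] at this
  · have := (gasketIdFun_restrict n _ c2).2.1
    rwa [r2, m1, Prod.mk_add_mk, add_zero, zero_add] at this

theorem gasketIdFun_mem_Icc (n : ℕ) {v : ℤ × ℤ} (hv : v ∈ gasketVerts (n + 1)) :
    gasketIdFun n v ∈ Set.Icc 2 3 := by
  have h2 : 2 ∈ Set.Icc 2 3 := by simp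
  rcases (mem_gasketVerts_succ_iff n v).1 hv with hw | ⟨w, hw, rfl⟩ | ⟨w, hw, rfl⟩
  · rw [(gasketIdFun_restrict n v hw).1]
    exact gasketM_mem_Icc n h2 h2 h2 hw
  · rw [(gasketIdFun_restrict n w hw).2.1]
    exact gasketM_mem_Icc n h2 h2 h2 ((rotCW_mem_iff n w).2 hw)
  · rw [(gasketIdFun_restrict n w hw).2.2]
    exact gasketM_mem_Icc n h2 h2 h2 ((rotCCW_mem_iff n w).2 hw)

/-- Here `χ` plays the indicator of the unburnt set. A corner has value 2 and only two neighbours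
besides the sink, so it burns at once; each copy is then burnt from its outer corner. -/
theorem gasketIdFun_burn (n : ℕ) {χ : ℤ × ℤ → ℤ} (h1 : ∀ v, χ v ≤ 1)
    (h : ∀ v ∈ gasketVerts (n + 1), χ v ≠ 0 →
      (gasketIdFun n v : ℤ) < gasketNbrSum (n + 1) χ v) :
    ∀ v ∈ gasketVerts (n + 1), χ v = 0 := by
  obtain ⟨d0, d1, d2⟩ := gasketVerts_corners (n + 1)
  obtain ⟨r0, r1, r2, s0, s1, s2⟩ := rot_corners n
  obtain ⟨v0, v1, v2, v3, v4, v5⟩ := gasketIdFun_special n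
  obtain ⟨b0, b1, b2⟩ := gasketNbrSum_corner_le_two (n + 1) h1
  obtain ⟨j0, j1, j2⟩ := gasketNbrSum_succ_junctions n χ
  obtain ⟨i0, i1, i2⟩ := isGasketInner_junctions n
  have z0 : χ (0, 0) = 0 := by
    by_contra hne
    have := h _ d0 hne
    rw [v0] at this
    push_cast at this; omega
  have z1 : χ ((2 : ℤ) ^ (n + 1), (0 : ℤ)) = 0 := by
    by_contra hne
    have := h _ d1 hne
    rw [v1] at this
    push_cast at this; omega
  have z2 : χ ((0 : ℤ), (2 : ℤ) ^ (n + 1)) = 0 := by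
    by_contra hne
    have := h _ d2 hne
    rw [v2] at this
    push_cast at this; omega
  have hl : ∀ v, IsGasketInner n v → χ v = 0 := gasketM_burn n h1 z0 2 2 2 fun v hv hne => by
    have := h v hv.succ.1.1 hne
    rwa [(gasketIdFun_restrict n v hv.1).1, gasketNbrSum_succ_left _ hv] at this
  -- The rotation moves the burnt outer corner of this copy to the lower left, where `gasketM_burn`
  -- expects it.
  have zr : χ (rotCCW n (0, 0) + ((2 : ℤ) ^ n, (0 : ℤ))) = 0 := by
    rw [s0, Prod.mk_add_mk, add_zero, ← mul_two, ← pow_succ, z1]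
  have hr : ∀ v, IsGasketInner n v → χ (rotCCW n v + ((2 : ℤ) ^ n, (0 : ℤ))) = 0 :=
    gasketM_burn n (χ := fun v => χ (rotCCW n v + ((2 : ℤ) ^ n, (0 : ℤ)))) (fun v => h1 _) zr 2 2 2
      fun v hv hne => by
        have := h _ hv.rotCCW.succ.2.1.1 hne
        rwa [(gasketIdFun_restrict n _ hv.rotCCW.1).2.1, gasketNbrSum_succ_right _ hv.rotCCW,
          rotCW_rotCCW, ← gasketNbrSum_rotCCW] at this
  have zt : χ (rotCW n (0, 0) + ((0 : ℤ), (2 : ℤ) ^ n)) = 0 := by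
    rw [r0, Prod.mk_add_mk, add_zero, ← mul_two, ← pow_succ, z2]
  have ht : ∀ v, IsGasketInner n v → χ (rotCW n v + ((0 : ℤ), (2 : ℤ) ^ n)) = 0 :=
    gasketM_burn n (χ := fun v => χ (rotCW n v + ((0 : ℤ), (2 : ℤ) ^ n))) (fun v => h1 _) zt 2 2 2
      fun v hv hne => by
        have := h _ hv.rotCW.succ.2.2.1 hne
        rwa [(gasketIdFun_restrict n _ hv.rotCW.1).2.2, gasketNbrSum_succ_top _ hv.rotCW,
          rotCCW_rotCW, ← gasketNbrSum_rotCW] at this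
  obtain ⟨a1, a2⟩ := gasketNbrSum_corner_le_one h1 z0 hl
  obtain ⟨a3, a4⟩ := gasketNbrSum_corner_le_one
    (χ := fun v => χ (rotCCW n v + ((2 : ℤ) ^ n, (0 : ℤ)))) (fun v => h1 _) zr hr
  obtain ⟨a5, a6⟩ := gasketNbrSum_corner_le_one
    (χ := fun v => χ (rotCW n v + ((0 : ℤ), (2 : ℤ) ^ n))) (fun v => h1 _) zt ht
  rw [gasketNbrSum_rotCCW n (fun v => χ (v + ((2 : ℤ) ^ n, (0 : ℤ))))] at a3 a4
  rw [gasketNbrSum_rotCW n (fun v => χ (v + ((0 : ℤ), (2 : ℤ) ^ n)))] at a5 a6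
  rw [s1] at a3
  rw [s2] at a4
  rw [r1] at a5
  rw [r2] at a6
  intro v hv
  rcases eq_corner_or_isGasketInner hv with rfl | rfl | rfl | hi
  · exact z0
  · exact z1
  · exact z2
  refine hi.succ_cases (P := fun v => χ v = 0) hl (fun v hv => ?_) (fun v hv => ?_) ?_ ?_ ?_
  · simpa only [rotCCW_rotCW] using hr _ hv.rotCW
  · simpa only [rotCW_rotCCW] using ht _ hv.rotCCW
  -- Each adjoining copy is burnt except possibly at its two inward corners, so a junction has at
  -- most `1 + 1` unburnt neighbours, which its value 2 matches.
  · by_contra hne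
    have := h _ i0.1 hne
    rw [v3, j0] at this
    push_cast at this; omega
  · by_contra hne
    have := h _ i1.1 hne
    rw [v4, j1] at this
    push_cast at this; omega
  · by_contra hne
    have := h _ i2.1 hne
    rw [v5, j2] at this
    push_cast at this; omega

/-- A forbidden set would be a set that never burns; its indicator function contradicts
`gasketIdFun_burn`. -/
theorem noForbidden_gasketIdConfig (n : ℕ) :
    NoForbidden (gasketGraph (n + 1)) (gasketIdConfig n) := by
  rintro S ⟨x, hx⟩
  by_contra! hlt
  have hmem : ∀ w : GasketVertex (n + 1),
      w.1 ∈ S.map (Function.Embedding.subtype _) ↔ w ∈ S := fun w => by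
    simp
  have := gasketIdFun_burn n
    (χ := fun v => if v ∈ S.map (Function.Embedding.subtype _) then 1 else 0)
    (fun v => by split_ifs <;> simp) (fun v hv hne => by
      have hvS : (⟨v, hv⟩ : GasketVertex (n + 1)) ∈ S := by
        rw [← hmem]; by_contra hn; exact hne (if_neg hn)
      have hc := hlt _ hvS
      rw [← sum_neighborFinset_gasketGraph (n + 1) _ ⟨v, hv⟩]
      simp only [hmem]
      rw [Finset.sum_boole, ← Finset.filter_mem_eq_inter] at *
      exact_mod_cast hc) x.1 x.2
  rw [if_pos ((hmem x).2 hx)] at this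
  exact one_ne_zero this

/-! ### Degrees with sink and the potential of the identity. -/

theorem normalSink_corner {n : ℕ} (v : GasketVertex n) (h : v.1 = (0, 0) ∨
    v.1 = ((2 : ℤ) ^ n, (0 : ℤ)) ∨ v.1 = ((0 : ℤ), (2 : ℤ) ^ n)) : normalSink n v = 2 :=
  if_pos h

theorem normalSink_inner {n : ℕ} (v : GasketVertex n) (h : IsGasketInner n v.1) :
    normalSink n v = 0 :=
  if_neg fun h' => h'.elim h.2.1 (Or.elim · h.2.2.1 h.2.2.2)

/-- The two sink edges raise the degree of a corner from 2 to 4, the degree of every inner vertex.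
-/
theorem sinkDegree_gasketGraph (n : ℕ) (v : GasketVertex n) :
    sinkDegree (gasketGraph n) (normalSink n) v = 4 := by
  have hd := sum_neighborFinset_gasketGraph n (fun _ => 1) v
  rw [Finset.sum_const, SimpleGraph.card_neighborFinset_eq_degree, nsmul_eq_mul, mul_one] at hd
  obtain ⟨d0, d1, d2, d3⟩ := gasketNbrSum_one n
  unfold sinkDegree
  rcases eq_corner_or_isGasketInner v.2 with h | h | h | h
  · rw [normalSink_corner v (.inl h)]; rw [h] at hd; omega
  · rw [normalSink_corner v (.inr (.inl h))]; rw [h] at hd; omega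
  · rw [normalSink_corner v (.inr (.inr h))]; rw [h] at hd; omega
  · rw [normalSink_inner v h]; have := d3 _ h; omega

theorem sinkLaplacian_gasketGraph (n : ℕ) (U : ℤ × ℤ → ℤ) (v : GasketVertex n) :
    sinkLaplacian (gasketGraph n) (normalSink n) (fun w => U w.1) v =
      gasketLap n U v.1 + normalSink n v * U v.1 := by
  rw [sinkLaplacian_eq_sum, sum_neighborFinset_gasketGraph n (fun w => U v.1 - U w)]
  rfl

theorem exists_sinkLaplacian_eq_gasketIdConfig (n : ℕ) : ∃ u : GasketVertex (n + 1) → ℤ,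
    ∀ v, (gasketIdConfig n v : ℤ) =
      sinkLaplacian (gasketGraph (n + 1)) (normalSink (n + 1)) u v := by
  obtain ⟨F, p, f0, f1, f2, g0, g1, g2, hF⟩ := exists_gasketLap_eq_gasketM n
  obtain ⟨r0, r1, r2, s0, s1, s2⟩ := rot_corners n
  obtain ⟨v0, v1, v2, v3, v4, v5⟩ := gasketIdFun_special n
  -- The constant gives the outer corners the potential `2 * 3 ^ n`. The two sink edges then add `4
  -- * 3 ^ n` to the Laplacian `2 - 4 * 3 ^ n`, leaving 2. At the junctions the copies agree because
  -- `F` vanishes at both inward corners, and the Laplacian is `1 + 1 = 2`.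
  let f : ℤ × ℤ → ℤ := fun v => F v + (2 * 3 ^ n - p)
  have hf : ∀ v, gasketLap n f v = gasketLap n F v := gasketLap_add_const n F _
  obtain ⟨U, hU⟩ := exists_isGasketGlue n f (fun v => f (rotCW n v)) (fun v => f (rotCCW n v))
    (by simp only [f, r0, f1, f2]) (by simp only [f, s0, f1, f2])
    (by simp only [f, r2, s1, f1, f2])
  obtain ⟨c0, c1, c2⟩ := hU.corners
  obtain ⟨l0, l1, l2⟩ := hU.lap_corners
  obtain ⟨j0, j1, j2⟩ := hU.lap_junctions
  simp only [gasketLap_rotCW, gasketLap_rotCCW, hf, r0, r1, r2, s0, s1, s2, g0, g1, g2]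
    at l0 l1 l2 j0 j1 j2
  simp only [f, r1, s2, f0] at c0 c1 c2
  refine ⟨fun v => U v.1, fun v => ?_⟩
  rw [sinkLaplacian_gasketGraph]
  change (gasketIdFun n v.1 : ℤ) = _
  rcases eq_corner_or_isGasketInner v.2 with h | h | h | h
  · rw [normalSink_corner v (.inl h), h, v0, l0, c0]; push_cast; ring
  · rw [normalSink_corner v (.inr (.inl h)), h, v1, l1, c1]; push_cast; ring
  · rw [normalSink_corner v (.inr (.inr h)), h, v2, l2, c2]; push_cast; ring
  · rw [normalSink_inner v h, Nat.cast_zero, zero_mul, add_zero]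
    refine h.succ_cases (P := fun v => (gasketIdFun n v : ℤ) = gasketLap (n + 1) U v)
      (fun v hv => ?_) (fun v hv => ?_) (fun v hv => ?_) ?_ ?_ ?_
    · rw [(gasketIdFun_restrict n v hv.1).1, hU.lap_left hv, hf, hF v hv]
    · rw [(gasketIdFun_restrict n v hv.1).2.1, hU.lap_right hv, gasketLap_rotCW, hf,
        hF _ hv.rotCW]
    · rw [(gasketIdFun_restrict n v hv.1).2.2, hU.lap_top hv, gasketLap_rotCCW, hf,
        hF _ hv.rotCCW]
    · rw [v3, j0]; rfl
    · rw [v4, j1]; rfl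
    · rw [v5, j2]; rfl

/-- For `n ≥ 1`, the identity element of the sandpile group of the Sierpiński gasket graph `G_{n+1}`
with normal boundary conditions is the configuration matched from `M_n`, `M_n⁺` and `M_n⁻`. -/
theorem theorem3p2 (n : ℕ) (hn : 1 ≤ n) : IsSandpileIdentity (n + 1) (gasketIdConfig n) := by
  obtain ⟨u, hu⟩ := exists_sinkLaplacian_eq_gasketIdConfig n
  have hval : ∀ v, gasketIdConfig n v ∈ Set.Icc 2 3 := fun v => gasketIdFun_mem_Icc n v.2
  refine isSandpileIdentity_of_sinkLaplacian (n + 1) _ (fun v => ?_)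
    (noForbidden_gasketIdConfig n) (fun v => ?_) u hu
  · rw [sinkDegree_gasketGraph]
    exact Nat.lt_succ_of_le (hval v).2
  · have := (hval v).1
    unfold gasketMax
    rw [sinkDegree_gasketGraph]
    omega
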